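/- Let $n \ge 0$, let $X$ be a connected CW-complex of dimension $2n$, and let $F$ be a field with $\operatorname{char}(F) = 0$ or $\operatorname{char}(F) > 2n$. Call a singular cohomology class $u \in H^2(X;F)$ atoroidal if $f^*u = 0 \in H^2(T^2;F)$ for every continuous map $f\colon T^2 = S^1\times S^1 \to X$. Assume that there is an atoroidal class $u \in H^2(X;F)$ whose $n$-fold cup power satisfies $u^n \neq 0 \in H^{2n}(X;F)$. Then $$\operatorname{TC}(X) = 2\dim(X) = 4n.$$ Here the topological complexity $\operatorname{TC}(X)$ is the least integer $k \ge 0$ such that $X \times X$ has an open cover $U_0,\dots,U_k$ for which there are continuous maps $s_j \colon U_j \to C([0,1],X)$ (compact-open topology) with $s_j(x,y)(0) = x$ and $s_j(x,y)(1) = y$ for all $(x,y)\in U_j$ and all $j$; it is $\infty$ if no such $k$ exists. -/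

import Mathlib

namespace TopCpx

open Topology

noncomputable section

/-! ### Singular cochains -/

/-- Singular `k`-simplices of `X`: continuous maps from the standard `k`-simplex to `X`. -/
abbrev Simp (k : ℕ) (X : Type*) [TopologicalSpace X] : Type _ :=
  C(stdSimplex ℝ (Fin (k + 1)), X)

section
variable {X : Type*} [TopologicalSpace X]

/-- Precomposition of a singular simplex with the affine map of standard simplices which is given
on vertices by `a`. -/
def Simp.restr {m k : ℕ} (σ : Simp k X) (a : Fin (m + 1) → Fin (k + 1)) : Simp m X :=
  σ.comp ⟨stdSimplex.map a, stdSimplex.continuous_map a⟩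

/-- The `i`-th face, opposite to the `i`-th vertex. -/
def Simp.face {k : ℕ} (σ : Simp (k + 1) X) (i : Fin (k + 2)) : Simp k X :=
  σ.restr i.succAbove

/-- The front `p`-face, spanned by the first `p + 1` vertices. -/
def Simp.front {p q k : ℕ} (h : p + q = k) (σ : Simp k X) : Simp p X :=
  σ.restr fun j => ⟨j, by omega⟩

/-- The back `q`-face, spanned by the last `q + 1` vertices. -/
def Simp.back {p q k : ℕ} (h : p + q = k) (σ : Simp k X) : Simp q X :=
  σ.restr fun j => ⟨p + j, by omega⟩

theorem Simp.restr_restr {l m k : ℕ} (σ : Simp k X) (a : Fin (m + 1) → Fin (k + 1))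
    (b : Fin (l + 1) → Fin (m + 1)) : (σ.restr a).restr b = σ.restr (a ∘ b) := by
  ext x
  simp [Simp.restr, stdSimplex.map_comp_apply]

end

/-- Singular `k`-cochains of `X` with coefficients in `F`: functions on the set of singular
`k`-simplices (equivalently, homomorphisms from the free abelian group on them to `F`). -/
abbrev Cochain (k : ℕ) (X : Type*) [TopologicalSpace X] (F : Type*) : Type _ := Simp k X → F

variable {X Y : Type*} [TopologicalSpace X] [TopologicalSpace Y] {F : Type*} [Field F]

/-- The singular coboundary. -/
def coboundary (k : ℕ) (X : Type*) [TopologicalSpace X] (F : Type*) [Field F] :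
    Cochain k X F →ₗ[F] Cochain (k + 1) X F where
  toFun f σ := ∑ i : Fin (k + 2), (-1) ^ (i : ℕ) * f (σ.face i)
  map_add' f g := by
    ext σ
    simp [mul_add, Finset.sum_add_distrib]
  map_smul' c f := by
    ext σ
    simp [Finset.mul_sum, mul_left_comm]

/-- The cup product of singular cochains (front face times back face). -/
def cupCochain {p q k : ℕ} (h : p + q = k) (f : Cochain p X F) (g : Cochain q X F) :
    Cochain k X F := fun σ => f (σ.front h) * g (σ.back h)

/-- The cochain map induced by a continuous map. -/
def pullCochain (k : ℕ) (φ : C(X, Y)) : Cochain k Y F →ₗ[F] Cochain k X F where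
  toFun f σ := f (φ.comp σ)
  map_add' _ _ := rfl
  map_smul' _ _ := rfl

/-- The Leibniz rule `d (f ∪ g) = d f ∪ g + (-1)^p f ∪ d g`, evaluated on a simplex. -/
theorem coboundary_cupCochain {p q k : ℕ} (h : p + q = k) (f : Cochain p X F)
    (g : Cochain q X F) (σ : Simp (k + 1) X) :
    coboundary k X F (cupCochain h f g) σ =
      coboundary p X F f (σ.front (p := p + 1) (q := q) (by omega)) *
          g (σ.back (p := p + 1) (q := q) (by omega)) +
        (-1) ^ p * (f (σ.front (p := p) (q := q + 1) (by omega)) *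
          coboundary q X F g (σ.back (p := p) (q := q + 1) (by omega))) := by
  subst h
  have e : (p + 1) + (q + 1) = p + q + 2 := by omega
  simp only [coboundary, cupCochain, LinearMap.coe_mk, AddHom.coe_mk]
  rw [← (finCongr e).sum_comp, Fin.sum_univ_add, Fin.sum_univ_castSucc (n := p + 1),
    Fin.sum_univ_succ (n := q + 1)]
  have A : ∀ i : Fin (p + 1),
      (-1 : F) ^ ((finCongr e (Fin.castAdd (q + 1) i) : Fin (p + q + 2)) : ℕ) *
        (f ((σ.face (finCongr e (Fin.castAdd (q + 1) i))).front rfl) *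
          g ((σ.face (finCongr e (Fin.castAdd (q + 1) i))).back rfl)) =
      (-1) ^ ((Fin.castSucc i : Fin (p + 2)) : ℕ) *
        f ((σ.front (p := p + 1) (q := q) (by omega)).face i.castSucc) *
        g (σ.back (p := p + 1) (q := q) (by omega)) := by
    intro i
    have h1 : (σ.face (finCongr e (Fin.castAdd (q + 1) i))).front rfl =
        (σ.front (p := p + 1) (q := q) (by omega)).face i.castSucc := by
      simp only [Simp.face, Simp.front, Simp.restr_restr]
      congr 1
      ext j
      simp only [Fin.succAbove, Function.comp, Fin.lt_def, finCongr_apply, Fin.val_cast,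
        Fin.val_castAdd, Fin.val_castSucc]
      split_ifs <;> simp
    have h2 : (σ.face (finCongr e (Fin.castAdd (q + 1) i))).back rfl =
        σ.back (p := p + 1) (q := q) (by omega) := by
      simp only [Simp.face, Simp.back, Simp.restr_restr]
      congr 1
      ext j
      simp only [Fin.succAbove, Function.comp, Fin.lt_def, finCongr_apply, Fin.val_cast,
        Fin.val_castAdd, Fin.val_castSucc]
      split_ifs <;> (simp; try omega)
    rw [h1, h2, mul_assoc]
    simp
  have B : ∀ j : Fin (q + 1),
      (-1 : F) ^ ((finCongr e (Fin.natAdd (p + 1) j) : Fin (p + q + 2)) : ℕ) *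
        (f ((σ.face (finCongr e (Fin.natAdd (p + 1) j))).front rfl) *
          g ((σ.face (finCongr e (Fin.natAdd (p + 1) j))).back rfl)) =
      (-1) ^ p * (f (σ.front (p := p) (q := q + 1) (by omega)) *
        ((-1) ^ (j.succ : ℕ) *
          g ((σ.back (p := p) (q := q + 1) (by omega)).face j.succ))) := by
    intro j
    have h1 : (σ.face (finCongr e (Fin.natAdd (p + 1) j))).front rfl =
        σ.front (p := p) (q := q + 1) (by omega) := by
      simp only [Simp.face, Simp.front, Simp.restr_restr]
      congr 1
      ext j
      simp only [Fin.succAbove, Function.comp, Fin.lt_def, finCongr_apply, Fin.val_cast,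
        Fin.val_natAdd, Fin.val_castSucc]
      split_ifs <;> (simp; try omega)
    have h2 : (σ.face (finCongr e (Fin.natAdd (p + 1) j))).back rfl =
        (σ.back (p := p) (q := q + 1) (by omega)).face j.succ := by
      simp only [Simp.face, Simp.back, Simp.restr_restr]
      congr 1
      ext j
      simp only [Fin.succAbove, Function.comp, Fin.lt_def, finCongr_apply, Fin.val_cast,
        Fin.val_natAdd, Fin.val_castSucc, Fin.val_succ]
      split_ifs <;> (simp; try omega)
    rw [h1, h2]
    simp only [finCongr_apply, Fin.val_cast, Fin.val_natAdd, Fin.val_succ]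
    ring
  have h1 : (σ.front (p := p + 1) (q := q) (by omega)).face (Fin.last (p + 1)) =
      σ.front (p := p) (q := q + 1) (by omega) := by
    simp only [Simp.face, Simp.front, Simp.restr_restr]
    congr 1
    ext j
    simp
  have h2 : (σ.back (p := p) (q := q + 1) (by omega)).face 0 =
      σ.back (p := p + 1) (q := q) (by omega) := by
    simp only [Simp.face, Simp.back, Simp.restr_restr]
    congr 1
    ext j
    simp
    omega
  rw [Finset.sum_congr rfl fun i _ => A i, Finset.sum_congr rfl fun j _ => B j, h1, h2,
    ← Finset.sum_mul, ← Finset.mul_sum, ← Finset.mul_sum]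
  simp only [Fin.val_last, Fin.val_zero]
  ring

theorem coboundary_pullCochain (k : ℕ) (φ : C(X, Y)) (f : Cochain k Y F) :
    coboundary k X F (pullCochain k φ f) = pullCochain (k + 1) φ (coboundary k Y F f) := rfl

/-! ### Singular cohomology -/

/-- Singular `k`-cocycles. -/
def Cocycles (k : ℕ) (X : Type*) [TopologicalSpace X] (F : Type*) [Field F] :
    Submodule F (Cochain k X F) := LinearMap.ker (coboundary k X F)

/-- Singular `k`-coboundaries (zero in degree `0`). -/
def Coboundaries (X : Type*) [TopologicalSpace X] (F : Type*) [Field F] :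
    (k : ℕ) → Submodule F (Cochain k X F)
  | 0 => ⊥
  | k + 1 => LinearMap.range (coboundary k X F)

/-- The singular cohomology group `H^k(X; F)`: cocycles modulo coboundaries. -/
abbrev H (k : ℕ) (X : Type*) [TopologicalSpace X] (F : Type*) [Field F] : Type _ :=
  Cocycles k X F ⧸ (Coboundaries X F k).submoduleOf (Cocycles k X F)

theorem pullCochain_mem_cocycles (k : ℕ) (φ : C(X, Y)) {f : Cochain k Y F}
    (hf : f ∈ Cocycles k Y F) : pullCochain k φ f ∈ Cocycles k X F := by
  rw [Cocycles, LinearMap.mem_ker] at hf ⊢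
  rw [coboundary_pullCochain, hf, map_zero]

theorem pullCochain_mem_coboundaries (k : ℕ) (φ : C(X, Y)) {f : Cochain k Y F}
    (hf : f ∈ Coboundaries Y F k) : pullCochain k φ f ∈ Coboundaries X F k := by
  cases k with
  | zero =>
    rw [Coboundaries, Submodule.mem_bot] at hf
    rw [hf, map_zero]
    exact Submodule.zero_mem _
  | succ k =>
    obtain ⟨g, rfl⟩ := hf
    exact ⟨pullCochain k φ g, rfl⟩

/-- The map `φ^* : H^k(Y; F) → H^k(X; F)` induced by a continuous map `φ : X → Y`. -/
def pull (k : ℕ) (φ : C(X, Y)) : H k Y F →ₗ[F] H k X F :=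
  Submodule.mapQ _ _
    ((pullCochain (F := F) k φ).restrict fun _ hf => pullCochain_mem_cocycles k φ hf)
    fun _ hf => pullCochain_mem_coboundaries k φ hf

theorem cupCochain_mem_cocycles {p q k : ℕ} (h : p + q = k) {f : Cochain p X F}
    {g : Cochain q X F} (hf : f ∈ Cocycles p X F) (hg : g ∈ Cocycles q X F) :
    cupCochain h f g ∈ Cocycles k X F := by
  rw [Cocycles, LinearMap.mem_ker] at *
  ext σ
  rw [coboundary_cupCochain, hf, hg]
  simp

theorem cupCochain_mem_coboundaries_left {p q k : ℕ} (h : p + q = k) {f : Cochain p X F}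
    {g : Cochain q X F} (hf : f ∈ Coboundaries X F p) (hg : g ∈ Cocycles q X F) :
    cupCochain h f g ∈ Coboundaries X F k := by
  cases p with
  | zero =>
    rw [Coboundaries, Submodule.mem_bot] at hf
    have : cupCochain h f g = 0 := by ext σ; simp [cupCochain, hf]
    rw [this]
    exact Submodule.zero_mem _
  | succ p =>
    obtain ⟨b, rfl⟩ := hf
    cases k with
    | zero => omega
    | succ k =>
      refine ⟨cupCochain (by omega) b g, ?_⟩
      rw [Cocycles, LinearMap.mem_ker] at hg
      ext σ
      rw [coboundary_cupCochain, hg]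
      simp [cupCochain]

theorem cupCochain_mem_coboundaries_right {p q k : ℕ} (h : p + q = k) {f : Cochain p X F}
    {g : Cochain q X F} (hf : f ∈ Cocycles p X F) (hg : g ∈ Coboundaries X F q) :
    cupCochain h f g ∈ Coboundaries X F k := by
  cases q with
  | zero =>
    rw [Coboundaries, Submodule.mem_bot] at hg
    have : cupCochain h f g = 0 := by ext σ; simp [cupCochain, hg]
    rw [this]
    exact Submodule.zero_mem _
  | succ q =>
    obtain ⟨b, rfl⟩ := hg
    cases k with
    | zero => omega
    | succ k =>
      refine ⟨(-1 : F) ^ p • cupCochain (by omega) f b, ?_⟩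
      rw [Cocycles, LinearMap.mem_ker] at hf
      ext σ
      rw [map_smul, Pi.smul_apply, coboundary_cupCochain, hf]
      simp [cupCochain, ← mul_assoc, ← mul_pow]

/-- The cup product of cocycles, as a bilinear map. -/
def cupCocycle {p q k : ℕ} (h : p + q = k) :
    Cocycles p X F →ₗ[F] Cocycles q X F →ₗ[F] Cocycles k X F :=
  LinearMap.mk₂ F (fun f g => ⟨cupCochain h f.1 g.1, cupCochain_mem_cocycles h f.2 g.2⟩)
    (fun f f' g => by ext σ; simp [cupCochain, add_mul])
    (fun c f g => by ext σ; simp [cupCochain, mul_assoc])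
    (fun f g g' => by ext σ; simp [cupCochain, mul_add])
    (fun c f g => by ext σ; simp [cupCochain, mul_left_comm])

/-- The cup product `H^p(X; F) × H^q(X; F) → H^k(X; F)`, where `p + q = k`, induced by the cup
product of cochains. -/
def cup {p q k : ℕ} (h : p + q = k) : H p X F →ₗ[F] H q X F →ₗ[F] H k X F :=
  Submodule.liftQ _
    { toFun := fun f => Submodule.mapQ _ _ (cupCocycle h f)
        fun g hg => cupCochain_mem_coboundaries_right h f.2 hg
      map_add' := fun f f' => by
        apply Submodule.linearMap_qext
        ext g
        rw [LinearMap.comp_apply, LinearMap.comp_apply, Submodule.mkQ_apply, LinearMap.add_apply]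
        simp only [map_add]
        rfl
      map_smul' := fun c f => by
        apply Submodule.linearMap_qext
        ext g
        simp only [map_smul]
        rfl }
    (by
      intro f hf
      rw [LinearMap.mem_ker]
      apply Submodule.linearMap_qext
      ext g
      simp only [LinearMap.coe_comp, Function.comp, LinearMap.coe_mk, AddHom.coe_mk,
        Submodule.mkQ_apply, LinearMap.zero_apply]
      exact (Submodule.Quotient.mk_eq_zero _).2 (cupCochain_mem_coboundaries_left h hf g.2))

/-- The unit `1 ∈ H^0(X; F)`, the class of the constant cochain `1`. -/
def one (X : Type*) [TopologicalSpace X] (F : Type*) [Field F] : H 0 X F :=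
  Submodule.Quotient.mk ⟨fun _ => 1, by
    rw [Cocycles, LinearMap.mem_ker]
    ext σ
    simp [coboundary, Fin.sum_univ_two]⟩

/-- The `n`-fold cup power `u^n ∈ H^{kn}(X; F)` of a class `u ∈ H^k(X; F)`. -/
def cupPow {k : ℕ} (u : H k X F) : (n : ℕ) → H (k * n) X F
  | 0 => one X F
  | n + 1 => cup (X := X) (F := F) (Nat.mul_succ k n).symm (cupPow u n) u

/-- A class `u ∈ H^k(X; F)` is atoroidal if `f^* u = 0` for every continuous map `f` from the
`k`-dimensional torus `(S^1)^k` to `X`. -/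
def Atoroidal {k : ℕ} (u : H k X F) : Prop :=
  ∀ f : C(Fin k → Circle, X), pull (F := F) k f u = 0

/-! ### Topological complexity -/

/-- There is a continuous choice of paths in `X` over `U ⊆ X × X`: a continuous section over `U` of
the end point map `C([0,1], X) → X × X`, where `C([0,1], X)` has the compact-open topology. -/
def HasMotionPlanner (U : Set (X × X)) : Prop :=
  ∃ s : C(U, C(unitInterval, X)), ∀ z : U, s z 0 = z.1.1 ∧ s z 1 = z.1.2

/-- The (reduced) topological complexity of `X`: the least `k` such that `X × X` has an open cover
by sets `U_0, …, U_k` with a continuous section of the end point map over each of them;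
`⊤` if there is no such `k`. -/
def TC (X : Type*) [TopologicalSpace X] : ℕ∞ :=
  ⨅ (k : ℕ) (_ : ∃ U : Fin (k + 1) → Set (X × X),
    (∀ i, IsOpen (U i)) ∧ (⋃ i, U i) = Set.univ ∧ ∀ i, HasMotionPlanner (U i)), (k : ℕ∞)

/-- The dimension of a CW complex: the supremum of the dimensions of its cells. -/
def cwDim (X : Type*) [TopologicalSpace X] [CWComplex (Set.univ : Set X)] : WithBot ℕ∞ :=
  ⨆ (m : ℕ) (_ : Nonempty (RelCWComplex.cell (Set.univ : Set X) m)), ((m : ℕ∞) : WithBot ℕ∞)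

end

end TopCpx

/-! The two inequalities are independent.

Upper bound (`TC_le`). A connected CW complex of dimension `N` is covered by `N + 1` open sets `{f i
> 0}`, each contractible in `X` to a base point (`exists_isContraction_cover`): one consists, near
each dimension, of the open cells, and the sets already built on a skeleton are thickened radially
into the next cells. On `{f i > 0} × {f j > 0}` a path is found by running one contraction forwards
and the other backwards. Comparing the sizes of the functions, normalized on each factor, regroups
these products into `2 * N + 1` open sets that are disjoint unions of open pieces of such products
(`TC_le_of_contractions`).

Lower bound (`le_TC`). Represent `u` by a cocycle `f` and put `v = pr₂^* f - pr₁^* f` on `X × X`. A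
motion planner over `U` is a homotopy between the two projections of `U`, so integrating `f` along
its paths gives a primitive of `v` over `U`, up to sign. With planners over both `U` and `V`, the
two primitives differ on `U ∩ V` by a 1-cocycle. Over a loop in `U ∩ V` the two families of paths
close up to a map of a torus to `X`, and the value of the 1-cocycle is that of `f` on this torus; it
vanishes because `u` is atoroidal. Hence the primitives can be made to agree, and one cochain `B`
makes `v - δB` vanish on all simplices in `U` or in `V` (`exists_cochain_of_hasMotionPlanner`). Thus
one factor of degree two disposes of two open sets, where the usual cup-length argument disposes of
one.

If `4 * n` sets sufficed, grouping them in pairs would represent `v^(2n)` by a product of `2 * n`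
cochains that vanishes on every simplex small for the cover, and by barycentric subdivision it would
vanish on all cycles (`pairing_eq_zero_of_small`). But if `z` is a cycle with `⟨u^n, z⟩ ≠ 0`, then
the value of `v^(2n)` on `z × z` is `(-1)^n * (2n choose n) * ⟨u^n, z⟩²`
(`ezEval_cupSeq_diffCochain`), which is nonzero by the assumption on the characteristic. -/

namespace TopCpx

open Topology

noncomputable section

/-! ### Formal chains on ordered tuples -/

namespace TupleChain

variable {A B : Type*} {F : Type*} [Field F]

/-- The augmented simplicial boundary of an ordered tuple. -/
def bdList (F : Type*) [Field F] : List A → (List A →₀ F)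
  | [] => 0
  | a :: l => Finsupp.single l 1 - Finsupp.lmapDomain F F (List.cons a) (bdList F l)

/-- The augmented simplicial boundary on chains of ordered tuples. -/
def bd : (List A →₀ F) →ₗ[F] (List A →₀ F) := Finsupp.linearCombination F (bdList F)

/-- Prepending a vertex. -/
def cone (a : A) : (List A →₀ F) →ₗ[F] (List A →₀ F) := Finsupp.lmapDomain F F (List.cons a)

/-- Appending a vertex. -/
def snoc (a : A) : (List A →₀ F) →ₗ[F] (List A →₀ F) :=
  Finsupp.lmapDomain F F (fun l => l ++ [a])

/-- The map on chains induced by a map of vertices. -/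
def map (g : A → B) : (List A →₀ F) →ₗ[F] (List B →₀ F) := Finsupp.lmapDomain F F (List.map g)

@[simp] theorem cone_single (a : A) (l : List A) (c : F) :
    cone a (Finsupp.single l c) = Finsupp.single (a :: l) c := by simp [cone]

@[simp] theorem snoc_single (a : A) (l : List A) (c : F) :
    snoc a (Finsupp.single l c) = Finsupp.single (l ++ [a]) c := by simp [snoc]

@[simp] theorem map_single (g : A → B) (l : List A) (c : F) :
    map g (Finsupp.single l c) = Finsupp.single (l.map g) c := by simp [map]

theorem bd_single (l : List A) : bd (Finsupp.single l (1 : F)) = bdList F l := by simp [bd]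

@[simp] theorem bd_nil : bd (Finsupp.single ([] : List A) (1 : F)) = 0 := by
  simp [bd_single, bdList]

theorem hom_ext {M : Type*} [AddCommMonoid M] [Module F M] {f g : (List A →₀ F) →ₗ[F] M}
    (h : ∀ l, f (Finsupp.single l 1) = g (Finsupp.single l 1)) : f = g := by
  apply Finsupp.lhom_ext'
  intro l
  ext
  simpa using h l

theorem bd_cone (a : A) (c : List A →₀ F) : bd (cone a c) = c - cone a (bd c) := by
  have : bd ∘ₗ cone a = LinearMap.id - cone (F := F) a ∘ₗ bd := by
    apply hom_ext
    intro l
    simp [bd_single, bdList, cone]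
  exact LinearMap.congr_fun this c

theorem bd_bd (c : List A →₀ F) : bd (bd c) = 0 := by
  have : bd ∘ₗ bd = (0 : (List A →₀ F) →ₗ[F] (List A →₀ F)) := by
    apply hom_ext
    intro l
    induction l with
    | nil => simp
    | cons a l ih =>
      simp only [LinearMap.comp_apply, LinearMap.zero_apply] at ih ⊢
      rw [← cone_single a l, bd_cone, map_sub, bd_cone, ih]
      simp
  exact LinearMap.congr_fun this c

theorem map_cone (g : A → B) (a : A) (c : List A →₀ F) :
    map g (cone a c) = cone (g a) (map g c) := by
  have : map g ∘ₗ cone a = cone (F := F) (g a) ∘ₗ map g := by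
    apply hom_ext
    intro l
    simp
  exact LinearMap.congr_fun this c

theorem map_snoc (g : A → B) (a : A) (c : List A →₀ F) :
    map g (snoc a c) = snoc (g a) (map g c) := by
  have : map g ∘ₗ snoc a = snoc (F := F) (g a) ∘ₗ map g := by
    apply hom_ext
    intro l
    simp
  exact LinearMap.congr_fun this c

theorem cone_snoc (a b : A) (c : List A →₀ F) : cone a (snoc b c) = snoc b (cone a c) := by
  have : cone a ∘ₗ snoc b = snoc (F := F) b ∘ₗ cone a := by
    apply hom_ext
    intro l
    simp
  exact LinearMap.congr_fun this c

theorem map_map {C : Type*} (g : A → B) (h : B → C) (c : List A →₀ F) :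
    map h (map g c) = map (h ∘ g) c := by
  have : map h ∘ₗ map g = map (F := F) (h ∘ g) := by
    apply hom_ext
    intro l
    simp
  exact LinearMap.congr_fun this c

theorem bd_map (g : A → B) (c : List A →₀ F) : bd (map g c) = map g (bd c) := by
  have : bd ∘ₗ map g = map (F := F) g ∘ₗ bd := by
    apply hom_ext
    intro l
    simp only [LinearMap.comp_apply]
    induction l with
    | nil => simp
    | cons a l ih =>
      rw [← cone_single a l, map_cone, bd_cone, bd_cone, ih, map_sub, map_cone]
  exact LinearMap.congr_fun this c

/-- The sign operator, multiplying a tuple of length `m` by `(-1) ^ m`. -/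
def sgn : (List A →₀ F) →ₗ[F] (List A →₀ F) :=
  Finsupp.linearCombination F fun l => Finsupp.single l ((-1) ^ l.length)

theorem sgn_single (l : List A) :
    sgn (Finsupp.single l (1 : F)) = Finsupp.single l ((-1) ^ l.length) := by simp [sgn]

theorem sgn_snoc (a : A) (c : List A →₀ F) : sgn (snoc a c) = - snoc a (sgn c) := by
  have : sgn ∘ₗ snoc a = - (snoc (F := F) a ∘ₗ sgn) := by
    apply hom_ext
    intro l
    simp only [LinearMap.comp_apply, LinearMap.neg_apply, snoc_single, sgn_single,
      ← Finsupp.single_neg]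
    simp [pow_succ]
  exact LinearMap.congr_fun this c

theorem bd_snoc (a : A) (c : List A →₀ F) : bd (snoc a c) = snoc a (bd c) + sgn c := by
  have : bd ∘ₗ snoc a = snoc (F := F) a ∘ₗ bd + sgn := by
    apply hom_ext
    intro l
    simp only [LinearMap.comp_apply, LinearMap.add_apply]
    induction l with
    | nil =>
      rw [bd_nil, snoc_single, bd_single, sgn_single]
      simp [bdList]
    | cons b l ih =>
      have h : sgn (Finsupp.single (b :: l) (1 : F)) = - cone b (sgn (Finsupp.single l 1)) := by
        simp only [sgn_single, cone_single, ← Finsupp.single_neg]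
        simp [pow_succ]
      rw [h, ← cone_single b l, bd_cone, ← cone_snoc, bd_cone, ih, map_sub, map_add, cone_snoc]
      abel
  exact LinearMap.congr_fun this c

theorem bdList_eq_sum (l : List A) :
    bdList F l = ∑ i ∈ Finset.range l.length, Finsupp.single (l.eraseIdx i) ((-1) ^ i) := by
  induction l with
  | nil => simp [bdList]
  | cons a l ih =>
    rw [bdList, ih, List.length_cons, Finset.sum_range_succ', map_sum]
    simp only [List.eraseIdx_cons_succ, List.eraseIdx_zero, List.tail_cons, pow_zero, pow_succ,
      Finsupp.lmapDomain_apply, Finsupp.mapDomain_single, mul_neg, mul_one, Finsupp.single_neg,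
      Finset.sum_neg_distrib]
    abel

end TupleChain

/-! ### Realizations of ordered tuples as singular simplices -/

/-- A natural way to turn tuples of vertices into singular simplices. -/
structure Realization (A X : Type*) [TopologicalSpace X] where
  /-- The singular simplex with the given vertices. -/
  simp : ∀ k, (Fin (k + 1) → A) → Simp k X
  restr : ∀ {m k : ℕ} (a : Fin (k + 1) → A) (b : Fin (m + 1) → Fin (k + 1)),
    (simp k a).restr b = simp m (a ∘ b)

namespace Realization

variable {A B X Y F : Type*} [TopologicalSpace X] [TopologicalSpace Y] [Field F]

/-- The value of a cochain on the simplex spanned by a tuple, and zero if the tuple does not have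
the right length. -/
def evList {k : ℕ} (R : Realization A X) (f : Cochain k X F) (l : List A) : F :=
  if h : l.length = k + 1 then f (R.simp k fun j => l.get (Fin.cast h.symm j)) else 0

/-- The linear extension of `evList`. -/
def ev {k : ℕ} (R : Realization A X) (f : Cochain k X F) : (List A →₀ F) →ₗ[F] F :=
  Finsupp.linearCombination F (R.evList f)

theorem ev_single {k : ℕ} (R : Realization A X) (f : Cochain k X F) (l : List A) (c : F) :
    R.ev f (Finsupp.single l c) = c * R.evList f l := by simp [ev]

theorem evList_of_length {k : ℕ} (R : Realization A X) (f : Cochain k X F) {l : List A}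
    (h : l.length = k + 1) :
    R.evList f l = f (R.simp k fun j => l.get (Fin.cast h.symm j)) := dif_pos h

theorem evList_of_length_ne {k : ℕ} (R : Realization A X) (f : Cochain k X F) {l : List A}
    (h : l.length ≠ k + 1) : R.evList f l = 0 := dif_neg h

/-- Erasing a vertex is passing to a face. Tuples of the wrong length give zero on both sides, so
chains of mixed lengths need no grading. -/
theorem evList_coboundary {k : ℕ} (R : Realization A X) (f : Cochain k X F) (l : List A) :
    R.evList (coboundary k X F f) l = R.ev f (TupleChain.bdList F l) := by
  rw [TupleChain.bdList_eq_sum, map_sum]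
  by_cases h : l.length = k + 2
  · rw [h, Finset.sum_range, R.evList_of_length _ h]
    simp only [coboundary, LinearMap.coe_mk, AddHom.coe_mk]
    refine Finset.sum_congr rfl fun i _ => ?_
    have hi : (l.eraseIdx i).length = k + 1 := by
      rw [List.length_eraseIdx_of_lt (by omega)]
      omega
    rw [ev_single, R.evList_of_length _ hi, Simp.face, R.restr]
    congr 3
    ext j
    simp only [Function.comp, List.get_eq_getElem, Fin.val_cast, List.getElem_eraseIdx,
      Fin.succAbove, Fin.lt_def, Fin.val_castSucc]
    split_ifs <;> simp
  · rw [R.evList_of_length_ne _ h]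
    symm
    refine Finset.sum_eq_zero fun i hi => ?_
    rw [Finset.mem_range] at hi
    rw [ev_single, R.evList_of_length_ne, mul_zero]
    rw [List.length_eraseIdx_of_lt hi]
    omega

theorem ev_coboundary {k : ℕ} (R : Realization A X) (f : Cochain k X F) (c : List A →₀ F) :
    R.ev (coboundary k X F f) c = R.ev f (TupleChain.bd c) := by
  have : R.ev (coboundary k X F f) = R.ev f ∘ₗ TupleChain.bd := by
    apply TupleChain.hom_ext
    intro l
    rw [LinearMap.comp_apply, TupleChain.bd_single, ev_single, one_mul, evList_coboundary]
  exact LinearMap.congr_fun this c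

/-- Precomposition with a map of vertices. -/
def comap (R : Realization A X) (g : B → A) : Realization B X where
  simp k a := R.simp k (g ∘ a)
  restr _ _ := R.restr _ _

theorem ev_map {k : ℕ} (R : Realization A X) (g : B → A) (f : Cochain k X F)
    (c : List B →₀ F) : R.ev f (TupleChain.map g c) = (R.comap g).ev f c := by
  have : R.ev f ∘ₗ TupleChain.map g = (R.comap g).ev f := by
    apply TupleChain.hom_ext
    intro l
    rw [LinearMap.comp_apply, TupleChain.map_single, ev_single, ev_single]
    congr 1
    by_cases h : l.length = k + 1
    · rw [evList_of_length _ _ h, evList_of_length _ _ (by simpa using h)]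
      simp only [comap]
      congr 2
      ext j
      simp
    · rw [evList_of_length_ne _ _ h, evList_of_length_ne _ _ (by simpa using h)]
  exact LinearMap.congr_fun this c

theorem ev_smul {k : ℕ} (R : Realization A X) (r : F) (f : Cochain k X F) (c : List A →₀ F) :
    R.ev (r • f) c = r * R.ev f c := by
  have : R.ev (r • f) = r • R.ev f := by
    apply TupleChain.hom_ext
    intro l
    by_cases h : l.length = k + 1
    · simp [ev_single, evList_of_length _ _ h]
    · simp [ev_single, evList_of_length_ne _ _ h]
  exact LinearMap.congr_fun this c

end Realization

/-! ### The shuffle product -/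

section Shuffle

open TupleChain

variable {F : Type*} [Field F]

/-- The signed sum of the lattice paths from `(0, 0)` to `(p - 1, q - 1)`. -/
def ez (F : Type*) [Field F] : ℕ → ℕ → (List (ℕ × ℕ) →₀ F)
  | 0, _ => 0
  -- The arguments count vertices, so `ez F (p + 1) (q + 1)` belongs to a `p`-simplex times a
  -- `q`-simplex. The empty path sits at `(1, 0)` only, so that the one-vertex path at `(1, 1)`
  -- arises exactly once.
  | 1, 0 => Finsupp.single [] 1
  | _ + 2, 0 => 0
  -- A final horizontal step is moved past `q` vertical steps, which gives the sign.
  | p + 1, q + 1 => (-1 : F) ^ q • snoc (p, q) (ez F p (q + 1)) + snoc (p, q) (ez F (p + 1) q)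
termination_by p q => p + q

/-- The `a`-th coface map on vertices. -/
def coface (a i : ℕ) : ℕ := if i < a then i else i + 1

theorem ez_zero_left (q : ℕ) : ez F 0 q = 0 := by rw [ez]

theorem ez_one_zero : ez F 1 0 = Finsupp.single [] 1 := by rw [ez]

theorem ez_add_two_zero (p : ℕ) : ez F (p + 2) 0 = 0 := by rw [ez]

theorem ez_succ_succ (p q : ℕ) : ez F (p + 1) (q + 1) =
    (-1 : F) ^ q • snoc (p, q) (ez F p (q + 1)) + snoc (p, q) (ez F (p + 1) q) := by
  rw [ez]

theorem map_ez (g : ℕ × ℕ → ℕ × ℕ) (p q : ℕ) (hg : ∀ i < p, ∀ j < q, g (i, j) = (i, j)) :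
    map g (ez F p q) = ez F p q := by
  induction p, q using ez.induct with
  | case1 q => simp [ez_zero_left]
  | case2 => simp [ez_one_zero]
  | case3 p => simp [ez_add_two_zero]
  | case4 p q h1 h2 =>
    rw [ez_succ_succ, map_add, map_smul, map_snoc, map_snoc, hg p (by omega) q (by omega),
      h1 fun i hi j hj => hg i (by omega) j hj, h2 fun i hi j hj => hg i hi j (by omega)]

theorem sgn_ez (p q : ℕ) : sgn (ez F p q) = - (-1 : F) ^ (p + q) • ez F p q := by
  induction p, q using ez.induct with
  | case1 q => simp [ez_zero_left]
  | case2 => simp [ez_one_zero, sgn_single]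
  | case3 p => simp [ez_add_two_zero]
  | case4 p q h1 h2 =>
    rw [ez_succ_succ, map_add, map_smul, sgn_snoc, sgn_snoc, h1, h2]
    simp only [map_smul, show p + (q + 1) = p + q + 1 by ring, show p + 1 + q = p + q + 1 by ring,
      show p + 1 + (q + 1) = p + q + 1 + 1 by ring, pow_succ]
    module

/-- The alternating sum of the first `n` cofaces in the first coordinate. -/
def cofaceL (n : ℕ) (c : List (ℕ × ℕ) →₀ F) : List (ℕ × ℕ) →₀ F :=
  ∑ a ∈ Finset.range n, (-1 : F) ^ a • map (Prod.map (coface a) id) c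

/-- The alternating sum of the first `n` cofaces in the second coordinate. -/
def cofaceR (n : ℕ) (c : List (ℕ × ℕ) →₀ F) : List (ℕ × ℕ) →₀ F :=
  ∑ b ∈ Finset.range n, (-1 : F) ^ b • map (Prod.map id (coface b)) c

theorem cofaceL_ez (n p q : ℕ) (hn : n ≤ p + 1) :
    cofaceL n (ez F (p + 1) (q + 1)) =
      (-1 : F) ^ q • snoc (p + 1, q) (cofaceL n (ez F p (q + 1))) +
        snoc (p + 1, q) (cofaceL n (ez F (p + 1) q)) := by
  simp only [cofaceL, map_sum, Finset.smul_sum, ← Finset.sum_add_distrib]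
  refine Finset.sum_congr rfl fun a ha => ?_
  have : coface a p = p + 1 := if_neg (by rw [Finset.mem_range] at ha; omega)
  rw [ez_succ_succ, map_add, map_smul, map_snoc, map_snoc, Prod.map_apply, this, id, smul_add,
    map_smul, map_smul, smul_comm]

theorem cofaceR_ez (n p q : ℕ) (hn : n ≤ q + 1) :
    cofaceR n (ez F (p + 1) (q + 1)) =
      (-1 : F) ^ q • snoc (p, q + 1) (cofaceR n (ez F p (q + 1))) +
        snoc (p, q + 1) (cofaceR n (ez F (p + 1) q)) := by
  simp only [cofaceR, map_sum, Finset.smul_sum, ← Finset.sum_add_distrib]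
  refine Finset.sum_congr rfl fun b hb => ?_
  have : coface b q = q + 1 := if_neg (by rw [Finset.mem_range] at hb; omega)
  rw [ez_succ_succ, map_add, map_smul, map_snoc, map_snoc, Prod.map_apply, this, id, smul_add,
    map_smul, map_smul, smul_comm]

/-- The first coordinates in `ez F p q` are below `p`, so the top coface does nothing. The term
split off here is the one that cancels in `bd_ez`. -/
theorem cofaceL_succ (p q : ℕ) :
    cofaceL (p + 1) (ez F p q) = cofaceL p (ez F p q) + (-1 : F) ^ p • ez F p q := by
  rw [cofaceL, Finset.sum_range_succ,
    map_ez (Prod.map (coface p) id) _ _ fun i hi j _ => by simp [coface, hi]]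
  rfl

theorem cofaceR_succ (p q : ℕ) :
    cofaceR (q + 1) (ez F p q) = cofaceR q (ez F p q) + (-1 : F) ^ q • ez F p q := by
  rw [cofaceR, Finset.sum_range_succ,
    map_ez (Prod.map id (coface q)) _ _ fun i _ j hj => by simp [coface, hj]]
  rfl

@[simp] theorem cofaceL_zero (n : ℕ) : cofaceL n (0 : List (ℕ × ℕ) →₀ F) = 0 := by simp [cofaceL]

@[simp] theorem cofaceR_zero (n : ℕ) : cofaceR n (0 : List (ℕ × ℕ) →₀ F) = 0 := by simp [cofaceR]

/-- The Leibniz rule for the shuffle product. Induction on `p + q` by removing the last vertex: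
deleting a corner gives the same path whether the last two steps were horizontal-vertical or
vertical-horizontal, with opposite signs, and what remains assembles into cofaces. -/
theorem bd_ez (p q : ℕ) : bd (ez F (p + 1) (q + 1)) =
    cofaceL (p + 1) (ez F p (q + 1)) + (-1 : F) ^ p • cofaceR (q + 1) (ez F (p + 1) q) := by
  induction h : p + q using Nat.strong_induction_on generalizing p q with
  | _ n ih =>
  rw [ez_succ_succ, map_add, map_smul, bd_snoc, bd_snoc, sgn_ez, sgn_ez]
  rcases p with _ | p <;> rcases q with _ | q
  · simp [ez_zero_left, ez_one_zero, cofaceR]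
  · rw [ih (0 + q) (by omega) 0 q rfl, cofaceR_succ (0 + 1) (q + 1), cofaceR_ez _ _ _ le_rfl]
    simp only [ez_zero_left, map_zero, smul_zero, cofaceL_zero, cofaceR_zero, zero_add, pow_zero,
      one_smul]
    congr 1
    ring_nf
  · rw [ih (p + 0) (by omega) p 0 rfl, cofaceL_succ (p + 1) (0 + 1), cofaceL_ez _ _ _ le_rfl]
    rcases p with _ | p
    · have : ez F 2 0 = 0 := ez_add_two_zero 0
      simp [ez_one_zero, ez_zero_left, cofaceR, cofaceL, this]
    · simp [ez_add_two_zero, pow_succ]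
  · rw [ih (p + (q + 1)) (by omega) p (q + 1) rfl, ih (p + 1 + q) (by omega) (p + 1) q rfl,
      cofaceL_succ (p + 1) (q + 1 + 1), cofaceR_succ (p + 1 + 1) (q + 1),
      cofaceL_ez (p + 1) p (q + 1) le_rfl, cofaceR_ez (q + 1) (p + 1) q le_rfl,
      cofaceL_succ (p + 1) (q + 1), cofaceR_succ (p + 1) (q + 1)]
    simp only [map_add, map_smul, pow_succ, pow_add]
    rcases neg_one_pow_eq_or F p with hp | hp <;> rcases neg_one_pow_eq_or F q with hq | hq <;>
      rw [hp, hq] <;> module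

end Shuffle

/-! ### Evaluation of cochains on products of simplices -/

section EzEval

variable {F : Type*} [Field F] {Y Z Y' Z' : Type*} [TopologicalSpace Y] [TopologicalSpace Z]
  [TopologicalSpace Y'] [TopologicalSpace Z']

/-- The vertex of the standard `p`-simplex with number `i`. -/
def clamp (p i : ℕ) : Fin (p + 1) := ⟨min i p, by omega⟩

/-- Simplices in the product of two simplices, given by their vertices. -/
def prodRealization {p q : ℕ} (σ : Simp p Y) (τ : Simp q Z) : Realization (ℕ × ℕ) (Y × Z) where
  simp k a := (σ.restr fun j => clamp p (a j).1).prodMk (τ.restr fun j => clamp q (a j).2)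
  restr a b := by
    ext x <;> simp [Simp.restr, stdSimplex.map_comp_apply] <;> rfl

/-- The value of a cochain on the shuffle product of two simplices. -/
def ezEval {p q k : ℕ} (f : Cochain k (Y × Z) F) (σ : Simp p Y) (τ : Simp q Z) : F :=
  (prodRealization σ τ).ev f (ez F (p + 1) (q + 1))

theorem ezEval_pull {p q k : ℕ} (φ : C(Y, Y')) (ψ : C(Z, Z')) (f : Cochain k (Y' × Z') F)
    (σ : Simp p Y) (τ : Simp q Z) :
    ezEval (pullCochain k (φ.prodMap ψ) f) σ τ = ezEval f (φ.comp σ) (ψ.comp τ) := rfl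

theorem ezEval_face_left {p q k : ℕ} (f : Cochain k (Y × Z) F) (σ : Simp (p + 1) Y)
    (τ : Simp q Z) (a : Fin (p + 2)) :
    ezEval f (σ.face a) τ = (prodRealization σ τ).ev f
      (TupleChain.map (Prod.map (coface a) id) (ez F (p + 1) (q + 1))) := by
  -- Truncation by `min p` fixes the vertices that occur. Inserting it makes the two realizations
  -- equal on all of `ℕ × ℕ`, so no bookkeeping of the occurring vertices is needed.
  rw [← map_ez (Prod.map (min p) id) (p + 1) (q + 1) fun i hi j _ => by
      rw [Prod.map_apply, min_eq_right (by omega)]; rfl,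
    TupleChain.map_map, Realization.ev_map, ezEval]
  congr 2
  simp only [prodRealization, Realization.comap, Simp.face, Simp.restr_restr]
  congr 1
  ext k x y
  swap
  · rfl
  congr 4
  ext j
  simp only [Function.comp, Prod.map_fst, coface, clamp, Fin.succAbove, Fin.lt_def,
    Fin.val_castSucc]
  split_ifs <;> simp <;> omega

theorem ezEval_face_right {p q k : ℕ} (f : Cochain k (Y × Z) F) (σ : Simp p Y)
    (τ : Simp (q + 1) Z) (b : Fin (q + 2)) :
    ezEval f σ (τ.face b) = (prodRealization σ τ).ev f
      (TupleChain.map (Prod.map id (coface b)) (ez F (p + 1) (q + 1))) := by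
  rw [← map_ez (Prod.map id (min q)) (p + 1) (q + 1) fun i _ j hj => by
      rw [Prod.map_apply, min_eq_right (by omega)]; rfl,
    TupleChain.map_map, Realization.ev_map, ezEval]
  congr 2
  simp only [prodRealization, Realization.comap, Simp.face, Simp.restr_restr]
  congr 1
  ext k x y
  · rfl
  congr 4
  ext j
  simp only [Function.comp, Prod.map_snd, coface, clamp, Fin.succAbove, Fin.lt_def,
    Fin.val_castSucc]
  split_ifs <;> simp <;> omega

theorem ezEval_coboundary {p q k : ℕ} (f : Cochain k (Y × Z) F) (σ : Simp (p + 1) Y)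
    (τ : Simp (q + 1) Z) : ezEval (coboundary k (Y × Z) F f) σ τ =
      ∑ a : Fin (p + 2), (-1) ^ (a : ℕ) * ezEval f (σ.face a) τ +
        (-1) ^ (p + 1) * ∑ b : Fin (q + 2), (-1) ^ (b : ℕ) * ezEval f σ (τ.face b) := by
  rw [ezEval, Realization.ev_coboundary, bd_ez, map_add, map_smul, smul_eq_mul, cofaceL, cofaceR,
    map_sum, map_sum, Finset.sum_range, Finset.sum_range]
  simp only [ezEval_face_left, ezEval_face_right, map_smul, smul_eq_mul]

end EzEval

/-! ### Barycentric subdivision -/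

namespace TupleChain

variable {A B F : Type*} [Field F]

/-- Subdivision of the tuples of length at most `n`, where `b a l` is the new vertex for `a :: l`. -/
def sd (F : Type*) [Field F] (b : A → List A → A) : ℕ → (List A →₀ F) →ₗ[F] (List A →₀ F)
  | 0 => LinearMap.id
  | n + 1 => Finsupp.linearCombination F fun l => match l with
    | [] => Finsupp.single [] 1
    | a :: l => cone (b a l) (sd F b n (bdList F (a :: l)))

/-- The chain homotopy between subdivision and the identity. -/
def sdHom (F : Type*) [Field F] (b : A → List A → A) : ℕ → (List A →₀ F) →ₗ[F] (List A →₀ F)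
  | 0 => 0
  | n + 1 => Finsupp.linearCombination F fun l => match l with
    | [] => 0
    | a :: l => cone (b a l) (Finsupp.single (a :: l) 1 - sdHom F b n (bdList F (a :: l)))

variable (b : A → List A → A)

theorem sd_zero : sd F b 0 = LinearMap.id := rfl

theorem sdHom_zero : sdHom F b 0 = 0 := rfl

theorem sd_succ_nil (n : ℕ) : sd F b (n + 1) (Finsupp.single [] 1) = Finsupp.single [] 1 := by
  simp [sd]

theorem sd_succ_cons (n : ℕ) (a : A) (l : List A) :
    sd F b (n + 1) (Finsupp.single (a :: l) 1) =
      cone (b a l) (sd F b n (bd (Finsupp.single (a :: l) 1))) := by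
  simp [sd, bd_single]

theorem sdHom_succ_nil (n : ℕ) : sdHom F b (n + 1) (Finsupp.single [] 1) = 0 := by
  simp [sdHom]

theorem sdHom_succ_cons (n : ℕ) (a : A) (l : List A) :
    sdHom F b (n + 1) (Finsupp.single (a :: l) 1) =
      cone (b a l) (Finsupp.single (a :: l) 1 - sdHom F b n (bd (Finsupp.single (a :: l) 1))) := by
  simp [sdHom, bd_single]

/-- The recursion depth drops by one because the boundary shortens tuples. It need not match the
length of a tuple here, since cutting off with the identity still gives a chain map; the length
matters only for smallness. -/
theorem bd_sd (n : ℕ) (c : List A →₀ F) : bd (sd F b (n + 1) c) = sd F b n (bd c) := by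
  have : bd ∘ₗ sd F b (n + 1) = sd F b n ∘ₗ bd := by
    apply hom_ext
    intro l
    induction n generalizing l with
    | zero =>
      rcases l with _ | ⟨a, l⟩
      · simp [sd_succ_nil]
      · simp only [LinearMap.comp_apply]
        rw [sd_succ_cons, bd_cone, sd_zero, LinearMap.id_apply, bd_bd, map_zero, sub_zero]
    | succ n ih =>
      rcases l with _ | ⟨a, l⟩
      · simp [sd_succ_nil]
      · have ih' := LinearMap.congr_fun (hom_ext ih)
        simp only [LinearMap.comp_apply] at ih' ⊢
        rw [sd_succ_cons, bd_cone, ih', bd_bd]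
        simp
  exact LinearMap.congr_fun this c

theorem bd_sdHom (n : ℕ) (c : List A →₀ F) :
    bd (sdHom F b (n + 1) c) + sdHom F b n (bd c) = c - sd F b (n + 1) c := by
  have : bd ∘ₗ sdHom F b (n + 1) + sdHom F b n ∘ₗ bd = LinearMap.id - sd F b (n + 1) := by
    apply hom_ext
    intro l
    induction n generalizing l with
    | zero =>
      rcases l with _ | ⟨a, l⟩
      · simp [sd_succ_nil, sdHom_succ_nil]
      · simp only [LinearMap.comp_apply, LinearMap.add_apply, LinearMap.sub_apply]
        rw [sdHom_succ_cons, sd_succ_cons, bd_cone, sd_zero, sdHom_zero]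
        simp only [LinearMap.zero_apply, LinearMap.id_apply, sub_zero, add_zero]
    | succ n ih =>
      rcases l with _ | ⟨a, l⟩
      · simp [sd_succ_nil, sdHom_succ_nil]
      · have ih' := LinearMap.congr_fun (hom_ext ih) (bd (Finsupp.single (a :: l) 1))
        simp only [LinearMap.comp_apply, LinearMap.add_apply, bd_bd, map_zero, add_zero,
          LinearMap.sub_apply, LinearMap.id_apply] at ih' ⊢
        rw [sdHom_succ_cons, sd_succ_cons, bd_cone, map_sub, ih']
        abel_nf
  exact LinearMap.congr_fun this c

theorem map_sd {b : A → List A → A} {b' : B → List B → B} {g : A → B}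
    (hg : ∀ a l, g (b a l) = b' (g a) (l.map g)) (n : ℕ) (c : List A →₀ F) :
    map g (sd F b n c) = sd F b' n (map g c) := by
  have : map g ∘ₗ sd F b n = sd F b' n ∘ₗ map g := by
    induction n with
    | zero => rfl
    | succ n ih =>
      apply hom_ext
      intro l
      simp only [LinearMap.comp_apply]
      rcases l with _ | ⟨a, l⟩
      · simp [sd_succ_nil]
      · rw [map_single, List.map_cons, sd_succ_cons, sd_succ_cons, map_cone, hg,
          ← List.map_cons, ← map_single, bd_map]
        congr 1
        exact LinearMap.congr_fun ih _
  exact LinearMap.congr_fun this c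

theorem map_sdHom {b : A → List A → A} {b' : B → List B → B} {g : A → B}
    (hg : ∀ a l, g (b a l) = b' (g a) (l.map g)) (n : ℕ) (c : List A →₀ F) :
    map g (sdHom F b n c) = sdHom F b' n (map g c) := by
  have : map g ∘ₗ sdHom F b n = sdHom F b' n ∘ₗ map g := by
    induction n with
    | zero => simp [sdHom]
    | succ n ih =>
      apply hom_ext
      intro l
      simp only [LinearMap.comp_apply]
      rcases l with _ | ⟨a, l⟩
      · simp [sdHom_succ_nil]
      · rw [map_single, List.map_cons, sdHom_succ_cons, sdHom_succ_cons, map_cone, hg,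
          ← List.map_cons, ← map_single, bd_map, map_sub]
        congr 2
        exact LinearMap.congr_fun ih _
  exact LinearMap.congr_fun this c

/-- The chain homotopy between the identity and the `m`-fold subdivision. -/
def iterSdHom (F : Type*) [Field F] (b : A → List A → A) (n m : ℕ) :
    (List A →₀ F) →ₗ[F] (List A →₀ F) :=
  ∑ i ∈ Finset.range m, sdHom F b n ∘ₗ sd F b n ^ i

theorem bd_sd_pow (n m : ℕ) (c : List A →₀ F) :
    bd ((sd F b (n + 1) ^ m) c) = (sd F b n ^ m) (bd c) := by
  induction m with
  | zero => simp
  | succ m ih => rw [pow_succ', pow_succ', Module.End.mul_apply, Module.End.mul_apply, bd_sd, ih]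

theorem bd_iterSdHom (n m : ℕ) (c : List A →₀ F) :
    bd (iterSdHom F b (n + 1) m c) + iterSdHom F b n m (bd c) = c - (sd F b (n + 1) ^ m) c := by
  induction m with
  | zero => simp [iterSdHom]
  | succ m ih =>
    have h := bd_sdHom b n ((sd F b (n + 1) ^ m) c)
    rw [bd_sd_pow] at h
    simp only [iterSdHom, Finset.sum_range_succ, LinearMap.add_apply, LinearMap.comp_apply,
      map_add] at ih ⊢
    rw [add_add_add_comm, ih, h, pow_succ', Module.End.mul_apply]
    abel

theorem map_sd_pow {b : A → List A → A} {b' : B → List B → B} {g : A → B}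
    (hg : ∀ a l, g (b a l) = b' (g a) (l.map g)) (n m : ℕ) (c : List A →₀ F) :
    map g ((sd F b n ^ m) c) = (sd F b' n ^ m) (map g c) := by
  induction m with
  | zero => simp
  | succ m ih =>
    rw [pow_succ', pow_succ', Module.End.mul_apply, Module.End.mul_apply, map_sd hg, ih]

theorem map_iterSdHom {b : A → List A → A} {b' : B → List B → B} {g : A → B}
    (hg : ∀ a l, g (b a l) = b' (g a) (l.map g)) (n m : ℕ) (c : List A →₀ F) :
    map g (iterSdHom F b n m c) = iterSdHom F b' n m (map g c) := by
  simp only [iterSdHom, LinearMap.sum_apply, map_sum, LinearMap.comp_apply, map_sdHom hg,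
    map_sd_pow hg]

theorem mem_supported_of_single {P : Set (List A)} {Q : Set (List B)}
    (f : (List A →₀ F) →ₗ[F] (List B →₀ F))
    (h : ∀ l ∈ P, f (Finsupp.single l 1) ∈ Finsupp.supported F F Q) {c : List A →₀ F}
    (hc : c ∈ Finsupp.supported F F P) : f c ∈ Finsupp.supported F F Q := by
  rw [Finsupp.supported_eq_span_single] at hc
  have : Submodule.span F ((fun i => Finsupp.single i (1 : F)) '' P) ≤
      (Finsupp.supported F F Q).comap f := by
    rw [Submodule.span_le]
    rintro _ ⟨l, hl, rfl⟩
    exact h l hl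
  exact this hc

theorem cone_mem_supported {P Q : Set (List A)} (a : A) (h : ∀ l ∈ P, a :: l ∈ Q)
    {c : List A →₀ F} (hc : c ∈ Finsupp.supported F F P) :
    cone a c ∈ Finsupp.supported F F Q :=
  mem_supported_of_single _ (fun l hl => by
    rw [cone_single]
    exact Finsupp.single_mem_supported F 1 (h l hl)) hc

theorem bd_mem_supported {P Q : Set (List A)} (h : ∀ l ∈ P, ∀ i < l.length, l.eraseIdx i ∈ Q)
    {c : List A →₀ F} (hc : c ∈ Finsupp.supported F F P) :
    bd c ∈ Finsupp.supported F F Q :=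
  mem_supported_of_single _ (fun l hl => by
    rw [bd_single, bdList_eq_sum]
    exact Submodule.sum_mem _ fun i hi =>
      Finsupp.single_mem_supported F _ (h l hl i (Finset.mem_range.1 hi))) hc

end TupleChain

/-! ### Affine simplices, and the shrinking of diameters under subdivision -/

section Affine

variable {E : Type*} [NormedAddCommGroup E] [NormedSpace ℝ E] {s : Set E}
  {X F : Type*} [TopologicalSpace X] [Field F]

/-- The affine singular simplex in a convex set with the given vertices. -/
def affineSimp (hs : Convex ℝ s) {k : ℕ} (a : Fin (k + 1) → s) : Simp k s where
  toFun t := ⟨∑ j, t j • (a j : E), hs.sum_mem (fun j _ => t.2.1 j) t.2.2 fun j _ => (a j).2⟩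
  continuous_toFun := by
    refine Continuous.subtype_mk (continuous_finsetSum _ fun j _ => ?_) _
    exact ((continuous_apply j).comp continuous_subtype_val).smul continuous_const

theorem affineSimp_restr (hs : Convex ℝ s) {m k : ℕ} (a : Fin (k + 1) → s)
    (b : Fin (m + 1) → Fin (k + 1)) :
    (affineSimp hs a).restr b = affineSimp hs (a ∘ b) := by
  ext t
  simp only [affineSimp, Simp.restr, ContinuousMap.comp_apply, ContinuousMap.coe_mk,
    Function.comp]
  have h : ∀ j, stdSimplex.map b t j = ∑ i with b i = j, t i := by
    intro j
    have := congrFun (stdSimplex.map_coe b t) j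
    rw [FunOnFinite.linearMap_apply_apply] at this
    exact this
  simp only [h, Finset.sum_smul]
  rw [← Finset.sum_fiberwise Finset.univ b (fun i => t i • (a (b i) : E))]
  refine Finset.sum_congr rfl fun j _ => Finset.sum_congr rfl fun i hi => ?_
  rw [(Finset.mem_filter.1 hi).2]

/-- Affine simplices in a convex set, mapped to `X`. -/
def affineRealization (hs : Convex ℝ s) (φ : C(s, X)) : Realization s X where
  simp _ a := φ.comp (affineSimp hs a)
  restr a b := by rw [← affineSimp_restr]; rfl

/-- The barycenter of the points `a :: l` of a convex set. -/
def bary (hs : Convex ℝ s) (a : s) (l : List s) : s :=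
  ⟨((l.length : ℝ) + 1)⁻¹ • ((a :: l).map Subtype.val).sum, by
    rw [← Fin.sum_univ_fun_getElem, Finset.smul_sum]
    refine hs.sum_mem (fun _ _ => by positivity) ?_ fun i _ => Subtype.coe_prop _
    rw [Finset.sum_const, Finset.card_univ, Fintype.card_fin]
    simp
    field_simp⟩

theorem dist_bary_le (hs : Convex ℝ s) (a : s) (l : List s) {d : ℝ}
    (hd : ∀ x ∈ a :: l, ∀ y ∈ a :: l, dist x y ≤ d) (y : s) (hy : y ∈ a :: l) :
    dist y (bary hs a l) ≤ l.length / (l.length + 1) * d := by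
  obtain ⟨j, hj, rfl⟩ := List.getElem_of_mem hy
  have hn : (0 : ℝ) < l.length + 1 := by positivity
  rw [dist_comm, Subtype.dist_eq, dist_eq_norm]
  have h1 : ((bary hs a l : s) : E) - ((a :: l)[j] : s) =
      ((l.length : ℝ) + 1)⁻¹ • ∑ i : Fin (a :: l).length, (((a :: l)[i.1] : s) - ((a :: l)[j] : s) : E) := by
    rw [Finset.sum_sub_distrib, Fin.sum_univ_fun_getElem (a :: l) (Subtype.val), smul_sub]
    congr 1
    rw [Finset.sum_const, Finset.card_univ, Fintype.card_fin, List.length_cons,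
      ← Nat.cast_smul_eq_nsmul ℝ, smul_smul]
    push_cast
    rw [inv_mul_cancel₀ hn.ne', one_smul]
  rw [h1, norm_smul, Real.norm_of_nonneg (by positivity), div_mul_eq_mul_div, inv_mul_eq_div]
  gcongr
  refine (norm_sum_le _ _).trans ?_
  have h2 : ∀ i : Fin (a :: l).length, ‖(((a :: l)[i.1] : s) - ((a :: l)[j] : s) : E)‖ ≤
      if i = ⟨j, hj⟩ then 0 else d := by
    intro i
    split_ifs with h
    · subst h; simp
    · rw [← dist_eq_norm, ← Subtype.dist_eq]
      exact hd _ (List.getElem_mem _) _ (List.getElem_mem _)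
  refine (Finset.sum_le_sum fun i _ => h2 i).trans ?_
  rw [Finset.sum_ite, Finset.sum_const_zero, zero_add, Finset.sum_const, Finset.filter_ne',
    Finset.card_erase_of_mem (Finset.mem_univ _), Finset.card_univ, Fintype.card_fin]
  simp

/-- The tuples of length `n` with vertices in `K` and mutual distances at most `d`. -/
def smallTuples (s K : Set E) (n : ℕ) (d : ℝ) : Set (List s) :=
  {l | l.length = n ∧ (∀ x ∈ l, (x : E) ∈ K) ∧ ∀ x ∈ l, ∀ y ∈ l, dist x y ≤ d}

/-- A simplex with `n` vertices shrinks by the factor `(n - 1) / n`. The convex set `K` is carried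
along so that the induction also confines the subdivided faces to a ball about the new barycenter.
-/
theorem sd_mem_supported (hs : Convex ℝ s) {K : Set E} (hK : Convex ℝ K) (n : ℕ) {d : ℝ}
    (hd : 0 ≤ d) {c : List s →₀ F} (hc : c ∈ Finsupp.supported F F (smallTuples s K n d)) :
    TupleChain.sd F (bary hs) n c ∈
      Finsupp.supported F F (smallTuples s K n ((n - 1 : ℝ) / n * d)) := by
  induction n generalizing c K with
  | zero =>
    simp only [TupleChain.sd, LinearMap.id_apply]
    refine Finsupp.supported_mono ?_ hc
    rintro l ⟨h0, -⟩
    rw [List.length_eq_zero_iff] at h0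
    subst h0
    simp [smallTuples]
  | succ n ih =>
    refine TupleChain.mem_supported_of_single _ ?_ hc
    rintro (_ | ⟨a, l⟩) ⟨h0, h1, h2⟩
    · simp at h0
    rw [TupleChain.sd_succ_cons]
    have hl : l.length = n := by simpa using h0
    have hb : ∀ y ∈ a :: l, dist y (bary hs a l) ≤ (n : ℝ) / (n + 1) * d := by
      rw [← hl]
      exact dist_bary_le hs a l h2
    -- The induction hypothesis is applied with `K` cut down to a closed ball about the barycenter.
    -- It bounds distances from the cone point; distances inside a face are bounded by the smaller
    -- factor for `n`.
    have key : TupleChain.sd F (bary hs) n (TupleChain.bd (Finsupp.single (a :: l) 1)) ∈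
        Finsupp.supported F F (smallTuples s
          (K ∩ Metric.closedBall (bary hs a l : E) ((n : ℝ) / (n + 1) * d)) n
          ((n - 1 : ℝ) / n * d)) := by
      refine ih (hK.inter (convex_closedBall _ _)) (TupleChain.bd_mem_supported (P := {a :: l}) ?_
        (Finsupp.single_mem_supported F 1 rfl))
      rintro _ rfl i hi
      have hsub : (a :: l).eraseIdx i ⊆ a :: l := List.eraseIdx_subset
      refine ⟨by rw [List.length_eraseIdx_of_lt hi, h0]; rfl, fun x hx => ⟨h1 x (hsub hx), ?_⟩,
        fun x hx y hy => h2 x (hsub hx) y (hsub hy)⟩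
      exact hb x (hsub hx)
    refine TupleChain.cone_mem_supported _ ?_ key
    rintro l' ⟨g0, g1, g2⟩
    have e : ((n + 1 : ℕ) - 1 : ℝ) / ((n + 1 : ℕ) : ℝ) * d = (n : ℝ) / (n + 1) * d := by
      push_cast; ring
    have hle : (n - 1 : ℝ) / n * d ≤ (n : ℝ) / (n + 1) * d := by
      gcongr ?_ * d
      rcases n with _ | n
      · simp
      · push_cast
        rw [div_le_div_iff₀ (by positivity) (by positivity)]
        nlinarith
    have hp : 0 ≤ (n : ℝ) / (n + 1) * d := by positivity
    have hbK : (bary hs a l : E) ∈ K := by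
      have := (bary (hK.inter hs) ⟨a, h1 a (by simp), a.2⟩
        (l.attach.map fun x => ⟨x.1, h1 x.1 (by simp [x.2]), x.1.2⟩)).2.1
      convert this using 1
      simp only [bary, List.length_map, List.length_attach, List.map_cons, List.map_map]
      congr 3
      have : l = l.attach.map Subtype.val := (List.attach_map_subtype_val l).symm
      conv_lhs => rw [this, List.map_map]
      rfl
    rw [e]
    refine ⟨by simp [g0], ?_, ?_⟩
    · intro x hx
      rcases List.mem_cons.1 hx with rfl | hx
      · exact hbK
      · exact (g1 x hx).1
    · intro x hx y hy
      rcases List.mem_cons.1 hx with rfl | hx <;> rcases List.mem_cons.1 hy with rfl | hy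
      · simpa using hp
      · rw [dist_comm]; exact (g1 y hy).2
      · exact (g1 x hx).2
      · exact (g2 x hx y hy).trans hle

/-- The vertices of the standard `k`-simplex. -/
def vertices (k : ℕ) : List (stdSimplex ℝ (Fin (k + 1))) :=
  List.ofFn fun i => stdSimplex.vertex (S := ℝ) i

theorem affineSimp_vertex (k : ℕ) :
    affineSimp (convex_stdSimplex ℝ (Fin (k + 1))) (fun i => stdSimplex.vertex (S := ℝ) i) =
      ContinuousMap.id _ := by
  ext t i
  change (∑ x, t x • (Pi.single x 1 : Fin (k + 1) → ℝ)) i = t i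
  simp [Finset.sum_apply, Pi.single_apply]

theorem ev_vertices {k : ℕ} (f : Cochain k X F) (σ : Simp k X) :
    (affineRealization (convex_stdSimplex ℝ (Fin (k + 1))) σ).ev f
      (Finsupp.single (vertices k) 1) = f σ := by
  have h : (vertices k).length = k + 1 := by simp [vertices]
  rw [Realization.ev_single, one_mul, Realization.evList_of_length _ _ h]
  have : (fun j => (vertices k).get (Fin.cast h.symm j)) =
      fun i => stdSimplex.vertex (S := ℝ) i := by
    ext1 j
    rw [List.get_eq_getElem]
    exact List.getElem_ofFn _
  rw [this]
  simp only [affineRealization, affineSimp_vertex, ContinuousMap.comp_id]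

theorem affineRealization_face {k : ℕ} (σ : Simp (k + 1) X) (i : Fin (k + 2)) :
    (affineRealization (convex_stdSimplex ℝ (Fin (k + 2))) σ).comap (stdSimplex.map i.succAbove) =
      affineRealization (convex_stdSimplex ℝ (Fin (k + 1))) (σ.face i) := by
  simp only [affineRealization, Realization.comap, Simp.face, Simp.restr, ContinuousMap.comp_assoc]
  congr 1
  ext m a t
  simp only [ContinuousMap.comp_apply, affineSimp, ContinuousMap.coe_mk, Function.comp]
  congr 1
  apply Subtype.ext
  change ∑ x, t x • FunOnFinite.linearMap ℝ ℝ i.succAbove (a x : Fin (k + 1) → ℝ) =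
    FunOnFinite.linearMap ℝ ℝ i.succAbove (∑ x, t x • (a x : Fin (k + 1) → ℝ))
  simp only [map_sum, map_smul]

theorem map_bary_stdSimplex {k m : ℕ} (g : Fin (k + 1) → Fin (m + 1))
    (a : stdSimplex ℝ (Fin (k + 1))) (l : List (stdSimplex ℝ (Fin (k + 1)))) :
    stdSimplex.map g (bary (convex_stdSimplex ℝ _) a l) =
      bary (convex_stdSimplex ℝ _) (stdSimplex.map g a) (l.map (stdSimplex.map g)) := by
  apply Subtype.ext
  change FunOnFinite.linearMap ℝ ℝ g (((l.length : ℝ) + 1)⁻¹ • ((a :: l).map Subtype.val).sum) = _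
  rw [map_smul, map_list_sum]
  simp only [bary, List.length_map, List.map_map, List.map_cons]
  rfl

theorem bd_vertices (k : ℕ) :
    TupleChain.bd (Finsupp.single (vertices (k + 1)) (1 : F)) = ∑ i : Fin (k + 2),
      (-1 : F) ^ (i : ℕ) • TupleChain.map (stdSimplex.map i.succAbove)
        (Finsupp.single (vertices k) 1) := by
  rw [TupleChain.bd_single, TupleChain.bdList_eq_sum,
    show (vertices (k + 1)).length = k + 2 by simp [vertices], Finset.sum_range]
  refine Finset.sum_congr rfl fun i _ => ?_
  rw [TupleChain.map_single, Finsupp.smul_single, smul_eq_mul, mul_one]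
  congr 1
  apply List.ext_getElem
  · rw [List.length_eraseIdx_of_lt (by simp [vertices]; omega)]
    simp [vertices]
  · intro j h1 h2
    simp only [vertices, List.getElem_eraseIdx, List.getElem_ofFn, List.getElem_map,
      stdSimplex.map_vertex, Fin.succAbove, Fin.lt_def, Fin.val_castSucc]
    split_ifs <;> rfl

/-- Subdivision does not change the class of a cocycle. -/
theorem exists_sub_ev_sd_pow {k : ℕ} {f : Cochain (k + 1) X F} (hf : f ∈ Cocycles (k + 1) X F)
    (m : ℕ) : ∃ g : Cochain k X F, ∀ σ : Simp (k + 1) X,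
      f σ - (affineRealization (convex_stdSimplex ℝ (Fin (k + 2))) σ).ev f
        ((TupleChain.sd F (bary (convex_stdSimplex ℝ _)) (k + 2) ^ m)
          (Finsupp.single (vertices (k + 1)) 1)) = coboundary k X F g σ := by
  -- The primitive evaluates `f` on the chain homotopy between the identity and iterated
  -- subdivision. Naturality under face inclusions turns the homotopy of the boundary into the
  -- coboundary of this cochain.
  refine ⟨fun τ => (affineRealization (convex_stdSimplex ℝ (Fin (k + 1))) τ).ev f
    (TupleChain.iterSdHom F (bary (convex_stdSimplex ℝ _)) (k + 1) m
      (Finsupp.single (vertices k) 1)), fun σ => ?_⟩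
  rw [← ev_vertices f σ, ← map_sub, ← TupleChain.bd_iterSdHom, map_add, ← Realization.ev_coboundary,
    LinearMap.mem_ker.1 hf, bd_vertices, map_sum, map_sum]
  have h0 : ∀ c, (affineRealization (convex_stdSimplex ℝ (Fin (k + 2))) σ).ev
      (0 : Cochain (k + 2) X F) c = 0 := by
    intro c
    simpa using Realization.ev_smul _ (0 : F) (0 : Cochain (k + 2) X F) c
  rw [h0, zero_add]
  simp only [coboundary, LinearMap.coe_mk, AddHom.coe_mk]
  refine Finset.sum_congr rfl fun i _ => ?_
  rw [map_smul, map_smul, smul_eq_mul, ← TupleChain.map_iterSdHom (map_bary_stdSimplex _),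
    Realization.ev_map, affineRealization_face]

theorem vertices_mem_supported (k : ℕ) :
    Finsupp.single (vertices k) (1 : F) ∈ Finsupp.supported F F
      (smallTuples (stdSimplex ℝ (Fin (k + 1))) Set.univ (k + 1)
        (Metric.diam (stdSimplex ℝ (Fin (k + 1))))) := by
  refine Finsupp.single_mem_supported F _ ⟨by simp [vertices], fun _ _ => trivial,
    fun x _ y _ => ?_⟩
  exact Metric.dist_le_diam_of_mem (bounded_stdSimplex _) x.2 y.2

theorem sd_pow_mem_supported (k m : ℕ) :
    (TupleChain.sd F (bary (convex_stdSimplex ℝ (Fin (k + 1)))) (k + 1) ^ m)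
      (Finsupp.single (vertices k) 1) ∈ Finsupp.supported F F
        (smallTuples (stdSimplex ℝ (Fin (k + 1))) Set.univ (k + 1)
          (((k : ℝ) / (k + 1)) ^ m * Metric.diam (stdSimplex ℝ (Fin (k + 1))))) := by
  induction m with
  | zero => simpa using vertices_mem_supported k
  | succ m ih =>
    rw [pow_succ' (TupleChain.sd _ _ _), Module.End.mul_apply]
    have := sd_mem_supported (convex_stdSimplex ℝ (Fin (k + 1))) convex_univ (k + 1)
      (by have := Metric.diam_nonneg (s := stdSimplex ℝ (Fin (k + 1))); positivity) ih
    convert this using 3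
    push_cast
    ring

/-- Iterated subdivisions of a simplex are eventually small with respect to an open cover. -/
theorem eventually_ev_sd_pow_eq_zero {ι : Type*} {U : ι → Set X} (hU : ∀ i, IsOpen (U i))
    (hc : ⋃ i, U i = Set.univ) {k : ℕ} {f : Cochain k X F}
    (hf : ∀ σ : Simp k X, (∃ i, ∀ x, σ x ∈ U i) → f σ = 0) (σ : Simp k X) :
    ∀ᶠ m : ℕ in Filter.atTop, (affineRealization (convex_stdSimplex ℝ (Fin (k + 1))) σ).ev f
      ((TupleChain.sd F (bary (convex_stdSimplex ℝ _)) (k + 1) ^ m)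
        (Finsupp.single (vertices k) 1)) = 0 := by
  obtain ⟨δ, hδ, h⟩ := lebesgue_number_lemma_of_metric
    (isCompact_univ (X := stdSimplex ℝ (Fin (k + 1))))
    (fun i => (hU i).preimage σ.continuous) (by
      rw [← Set.preimage_iUnion, hc, Set.preimage_univ])
  have ht : Filter.Tendsto (fun m : ℕ => ((k : ℝ) / (k + 1)) ^ m *
      Metric.diam (stdSimplex ℝ (Fin (k + 1)))) Filter.atTop (𝓝 0) := by
    have := (tendsto_pow_atTop_nhds_zero_of_lt_one (r := (k : ℝ) / (k + 1)) (by positivity)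
      (by rw [div_lt_one (by positivity)]; linarith)).mul_const
        (Metric.diam (stdSimplex ℝ (Fin (k + 1))))
    simpa using this
  filter_upwards [ht.eventually_lt_const hδ] with m hm
  have key := sd_pow_mem_supported (F := F) k m
  rw [Finsupp.mem_supported] at key
  rw [Realization.ev, Finsupp.linearCombination_apply, Finsupp.sum]
  refine Finset.sum_eq_zero fun l hl => ?_
  obtain ⟨h0, -, h2⟩ := key hl
  rw [Realization.evList_of_length _ _ h0, hf, smul_zero]
  have hl0 : l.get (Fin.cast h0.symm 0) ∈ l := List.get_mem _ _
  -- All vertices lie in the Lebesgue ball about the first one, and balls are convex, so the whole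
  -- affine simplex lies there.
  obtain ⟨i, hi⟩ := h (l.get (Fin.cast h0.symm 0)) trivial
  refine ⟨i, fun x => hi ?_⟩
  rw [Metric.mem_ball, Subtype.dist_eq, ← Metric.mem_ball]
  simp only [affineSimp, ContinuousMap.coe_mk]
  refine (convex_ball _ _).sum_mem (fun j _ => x.2.1 j) x.2.2 fun j _ => ?_
  rw [Metric.mem_ball, ← Subtype.dist_eq]
  exact (h2 _ (List.get_mem _ _) _ hl0).trans_lt hm

end Affine

/-! ### Cycles -/

section Cycles

variable {X F : Type*} [TopologicalSpace X] [Field F]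

/-- The value of a cochain on a singular chain. -/
def pairing {k : ℕ} (f : Cochain k X F) : (Simp k X →₀ F) →ₗ[F] F := Finsupp.linearCombination F f

theorem pairing_single {k : ℕ} (f : Cochain k X F) (σ : Simp k X) (c : F) :
    pairing f (Finsupp.single σ c) = c * f σ := by simp [pairing]

/-- A singular chain of positive degree is a cycle if all coboundaries vanish on it. -/
def IsCycle {k : ℕ} (z : Simp (k + 1) X →₀ F) : Prop :=
  ∀ g : Cochain k X F, pairing (coboundary k X F g) z = 0

/-- Subdivision changes `f` by a coboundary, invisible to a cycle, and as `z` involves finitely many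
simplices, one iterate makes all of them small. -/
theorem pairing_eq_zero_of_small {ι : Type*} {U : ι → Set X} (hU : ∀ i, IsOpen (U i))
    (hc : ⋃ i, U i = Set.univ) {k : ℕ} {f : Cochain (k + 1) X F}
    (hf : f ∈ Cocycles (k + 1) X F)
    (hs : ∀ σ : Simp (k + 1) X, (∃ i, ∀ x, σ x ∈ U i) → f σ = 0)
    {z : Simp (k + 1) X →₀ F} (hz : IsCycle z) : pairing f z = 0 := by
  have : ∀ᶠ m : ℕ in Filter.atTop, ∀ σ ∈ z.support,
      (affineRealization (convex_stdSimplex ℝ (Fin (k + 2))) σ).ev f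
        ((TupleChain.sd F (bary (convex_stdSimplex ℝ _)) (k + 2) ^ m)
          (Finsupp.single (vertices (k + 1)) 1)) = 0 := by
    rw [Filter.eventually_all_finset]
    exact fun σ _ => eventually_ev_sd_pow_eq_zero hU hc hs σ
  obtain ⟨m, hm⟩ := this.exists
  obtain ⟨g, hg⟩ := exists_sub_ev_sd_pow hf m
  rw [← hz g]
  simp only [pairing, Finsupp.linearCombination_apply]
  refine Finsupp.sum_congr fun σ hσ => ?_
  rw [← hg σ, hm σ hσ, sub_zero]

/-- Duality over a field: a functional that kills the kernel of the boundary map `D` factors through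
`D`, hence is a coboundary. -/
theorem exists_isCycle_of_notMem {k : ℕ} {f : Cochain (k + 1) X F}
    (hf : f ∉ Coboundaries X F (k + 1)) :
    ∃ z : Simp (k + 1) X →₀ F, IsCycle z ∧ pairing f z ≠ 0 := by
  let D : (Simp (k + 1) X →₀ F) →ₗ[F] (Simp k X →₀ F) := Finsupp.linearCombination F fun σ =>
    ∑ i : Fin (k + 2), Finsupp.single (σ.face i) ((-1) ^ (i : ℕ))
  have hD : ∀ (g : Cochain k X F), pairing g ∘ₗ D = pairing (coboundary k X F g) := by
    intro g
    apply Finsupp.lhom_ext'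
    intro σ
    ext
    simp [D, pairing, coboundary]
  by_contra! h
  apply hf
  have : pairing f ∈ LinearMap.range D.dualMap := by
    rw [LinearMap.range_dualMap_eq_dualAnnihilator_ker, Submodule.mem_dualAnnihilator]
    intro z hz
    refine h z fun g => ?_
    rw [← hD, LinearMap.comp_apply, LinearMap.mem_ker.1 hz, map_zero]
  obtain ⟨g, hg⟩ := this
  refine ⟨fun τ => g (Finsupp.single τ 1), ?_⟩
  ext σ
  have h1 : pairing (fun τ => g (Finsupp.single τ 1)) = g := by
    apply Finsupp.lhom_ext'
    intro τ
    ext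
    simp [pairing]
  have h2 := LinearMap.congr_fun (hD fun τ => g (Finsupp.single τ 1)) (Finsupp.single σ 1)
  rw [h1, pairing_single, one_mul] at h2
  rw [← h2]
  have h3 := LinearMap.congr_fun hg (Finsupp.single σ 1)
  rw [pairing_single, one_mul] at h3
  exact h3

end Cycles

/-! ### Products of cochains of degree two -/

section CupSeq

variable {X Y F : Type*} [TopologicalSpace X] [TopologicalSpace Y] [Field F]

/-- The product `g 0 ∪ ⋯ ∪ g (m - 1)` of cochains of degree two. -/
def cupSeq (g : ℕ → Cochain 2 X F) : (m : ℕ) → Cochain (2 * m) X F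
  | 0 => fun _ => 1
  | m + 1 => cupCochain (Nat.mul_succ 2 m).symm (cupSeq g m) (g m)

theorem cupSeq_succ (g : ℕ → Cochain 2 X F) (m : ℕ) :
    cupSeq g (m + 1) = cupCochain (Nat.mul_succ 2 m).symm (cupSeq g m) (g m) := rfl

theorem cupSeq_mem_cocycles {g : ℕ → Cochain 2 X F} (hg : ∀ i, g i ∈ Cocycles 2 X F) (m : ℕ) :
    cupSeq g m ∈ Cocycles (2 * m) X F := by
  induction m with
  | zero =>
    rw [Cocycles, LinearMap.mem_ker]
    ext σ
    simp [coboundary, cupSeq, Fin.sum_univ_two]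
  | succ m ih => exact cupCochain_mem_cocycles _ ih (hg m)

/-- The factors may vary with the index because the lower bound replaces each factor of a power by
its own cohomologous representative. -/
theorem cupSeq_sub_mem_coboundaries {g g' : ℕ → Cochain 2 X F}
    (hg : ∀ i, g i ∈ Cocycles 2 X F) (hg' : ∀ i, g' i ∈ Cocycles 2 X F)
    (h : ∀ i, g i - g' i ∈ Coboundaries X F 2) (m : ℕ) :
    cupSeq g m - cupSeq g' m ∈ Coboundaries X F (2 * m) := by
  induction m with
  | zero => simp [cupSeq]
  | succ m ih =>
    have e : cupSeq g (m + 1) - cupSeq g' (m + 1) =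
        cupCochain (Nat.mul_succ 2 m).symm (cupSeq g m - cupSeq g' m) (g m) +
        cupCochain (Nat.mul_succ 2 m).symm (cupSeq g' m) (g m - g' m) := by
      ext σ
      simp only [cupSeq, cupCochain, Pi.sub_apply, Pi.add_apply]
      ring
    rw [e]
    exact Submodule.add_mem _ (cupCochain_mem_coboundaries_left _ ih (hg m))
      (cupCochain_mem_coboundaries_right _ (cupSeq_mem_cocycles hg' m) (h m))

theorem cupPow_mk (f : Cocycles 2 X F) (n : ℕ) :
    cupPow (X := X) (F := F) (Submodule.Quotient.mk f) n =
      Submodule.Quotient.mk ⟨cupSeq (fun _ => f.1) n, cupSeq_mem_cocycles (fun _ => f.2) n⟩ := by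
  induction n with
  | zero => rfl
  | succ n ih =>
    rw [cupPow, ih]
    rfl

theorem cupSeq_eq_zero {g : ℕ → Cochain 2 X F} {U : Set X} {j m : ℕ} (hj : j < m)
    (hg : ∀ σ : Simp 2 X, (∀ x, σ x ∈ U) → g j σ = 0) (σ : Simp (2 * m) X)
    (hσ : ∀ x, σ x ∈ U) : cupSeq g m σ = 0 := by
  induction m with
  | zero => omega
  | succ m ih =>
    rw [cupSeq_succ, cupCochain]
    rcases Nat.lt_succ_iff_lt_or_eq.1 hj with h | rfl
    · rw [ih h _ fun x => hσ _, zero_mul]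
    · rw [hg _ fun x => hσ _, mul_zero]

/-- A cochain of degree two is normalized if it vanishes on degenerate simplices. -/
def Normalized (f : Cochain 2 X F) : Prop :=
  ∀ τ : Simp 1 X, f (τ.restr ![0, 0, 1]) = 0 ∧ f (τ.restr ![0, 1, 1]) = 0

theorem Normalized.restr_eq_zero {f : Cochain 2 X F} (hf : Normalized f) {p : ℕ} (σ : Simp p X)
    (a : Fin 3 → Fin (p + 1)) (ha : a 0 = a 1 ∨ a 1 = a 2) : f (σ.restr a) = 0 := by
  rcases ha with h | h
  · have : a = ![a 0, a 2] ∘ ![0, 0, 1] := by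
      ext i
      fin_cases i <;> simp [h]
    rw [this, ← Simp.restr_restr]
    exact (hf _).1
  · have : a = ![a 0, a 2] ∘ ![0, 1, 1] := by
      ext i
      fin_cases i <;> simp [h]
    rw [this, ← Simp.restr_restr]
    exact (hf _).2

theorem coboundary_coboundary {k : ℕ} (g : Cochain k X F) :
    coboundary (k + 1) X F (coboundary k X F g) = 0 := by
  ext σ
  rw [← ev_vertices (coboundary (k + 1) X F (coboundary k X F g)) σ, Realization.ev_coboundary,
    Realization.ev_coboundary, TupleChain.bd_bd, map_zero]
  rfl

theorem coboundary_one_apply (g : Cochain 1 X F) (σ : Simp 2 X) :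
    coboundary 1 X F g σ = g (σ.face 0) - g (σ.face 1) + g (σ.face 2) := by
  change ∑ i : Fin 3, (-1) ^ (i : ℕ) * g (σ.face i) = _
  rw [Fin.sum_univ_three]
  simp
  ring

theorem coboundary_two_apply (g : Cochain 2 X F) (σ : Simp 3 X) :
    coboundary 2 X F g σ = g (σ.face 0) - g (σ.face 1) + g (σ.face 2) - g (σ.face 3) := by
  change ∑ i : Fin 4, (-1) ^ (i : ℕ) * g (σ.face i) = _
  rw [Fin.sum_univ_four]
  simp [pow_succ]
  ring

/-- The cocycle condition on the degenerate 3-simplices `[0,0,0,1]` and `[0,1,1,1]` shows that `f`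
takes on `[0,0,1]` and `[0,1,1]` its values on the constant simplices at the vertices 0 and 1.
Subtracting the coboundary of the cochain `g` that records the value at the initial vertex removes
both. -/
theorem exists_normalized {f : Cochain 2 X F} (hf : f ∈ Cocycles 2 X F) :
    ∃ f' ∈ Cocycles 2 X F, Normalized f' ∧ f - f' ∈ Coboundaries X F 2 := by
  let g : Cochain 1 X F := fun τ => f (τ.restr ![0, 0, 0])
  refine ⟨f - coboundary 1 X F g, ?_, fun τ => ?_, ?_⟩
  · exact Submodule.sub_mem _ hf (LinearMap.mem_ker.2 (coboundary_coboundary g))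
  · have h1 := congrFun (LinearMap.mem_ker.1 hf) (τ.restr ![0, 0, 0, 1])
    have h2 := congrFun (LinearMap.mem_ker.1 hf) (τ.restr ![0, 1, 1, 1])
    have a0 : ![0, 0, 0, 1] ∘ (0 : Fin 4).succAbove = (![0, 0, 1] : Fin 3 → Fin 2) := by decide
    have a1 : ![0, 0, 0, 1] ∘ (1 : Fin 4).succAbove = (![0, 0, 1] : Fin 3 → Fin 2) := by decide
    have a2 : ![0, 0, 0, 1] ∘ (2 : Fin 4).succAbove = (![0, 0, 1] : Fin 3 → Fin 2) := by decide
    have a3 : ![0, 0, 0, 1] ∘ (3 : Fin 4).succAbove = (![0, 0, 0] : Fin 3 → Fin 2) := by decide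
    have b0 : ![0, 1, 1, 1] ∘ (0 : Fin 4).succAbove = (![1, 1, 1] : Fin 3 → Fin 2) := by decide
    have b1 : ![0, 1, 1, 1] ∘ (1 : Fin 4).succAbove = (![0, 1, 1] : Fin 3 → Fin 2) := by decide
    have b2 : ![0, 1, 1, 1] ∘ (2 : Fin 4).succAbove = (![0, 1, 1] : Fin 3 → Fin 2) := by decide
    have b3 : ![0, 1, 1, 1] ∘ (3 : Fin 4).succAbove = (![0, 1, 1] : Fin 3 → Fin 2) := by decide
    have c0 : (![0, 0, 1] ∘ (0 : Fin 3).succAbove) ∘ ![0, 0, 0] = (![0, 0, 0] : Fin 3 → Fin 2) := by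
      decide
    have c1 : (![0, 0, 1] ∘ (1 : Fin 3).succAbove) ∘ ![0, 0, 0] = (![0, 0, 0] : Fin 3 → Fin 2) := by
      decide
    have c2 : (![0, 0, 1] ∘ (2 : Fin 3).succAbove) ∘ ![0, 0, 0] = (![0, 0, 0] : Fin 3 → Fin 2) := by
      decide
    have d0 : (![0, 1, 1] ∘ (0 : Fin 3).succAbove) ∘ ![0, 0, 0] = (![1, 1, 1] : Fin 3 → Fin 2) := by
      decide
    have d1 : (![0, 1, 1] ∘ (1 : Fin 3).succAbove) ∘ ![0, 0, 0] = (![0, 0, 0] : Fin 3 → Fin 2) := by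
      decide
    have d2 : (![0, 1, 1] ∘ (2 : Fin 3).succAbove) ∘ ![0, 0, 0] = (![0, 0, 0] : Fin 3 → Fin 2) := by
      decide
    rw [coboundary_two_apply] at h1 h2
    rw [Pi.sub_apply, Pi.sub_apply, coboundary_one_apply, coboundary_one_apply]
    simp only [Simp.face, Simp.restr_restr, Pi.zero_apply, g, a0, a1, a2, a3, b0, b1, b2, b3,
      c0, c1, c2, d0, d1, d2] at h1 h2 ⊢
    constructor
    · linear_combination h1
    · linear_combination - h2
  · rw [sub_sub_cancel]
    exact ⟨g, rfl⟩

end CupSeq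

/-! ### Powers of the difference class on products of simplices -/

section Evaluation

open TupleChain

variable {A X F : Type*} [TopologicalSpace X] [Field F]

/-- The back 2-face sees only the last three vertices, so fixing these makes the second factor a
constant. -/
theorem Realization.ev_cupCochain {p k : ℕ} (R : Realization A X) (h : p + 2 = k)
    (f : Cochain p X F) (g : Cochain 2 X F) (w x y : A) (c : List A →₀ F) :
    R.ev (cupCochain h f g) (snoc y (snoc x (snoc w c))) =
      R.ev f (snoc w c) * R.evList g [w, x, y] := by
  subst h
  have : R.ev (cupCochain rfl f g) ∘ₗ snoc y ∘ₗ snoc x ∘ₗ snoc w =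
      (R.evList g [w, x, y]) • R.ev f ∘ₗ snoc w := by
    apply hom_ext
    intro l
    simp only [LinearMap.comp_apply, LinearMap.smul_apply, snoc_single, ev_single, one_mul,
      smul_eq_mul]
    by_cases h : l.length = p
    · rw [R.evList_of_length _ (l := l ++ [w] ++ [x] ++ [y]) (by simp [h]),
        R.evList_of_length _ (l := l ++ [w]) (by simp [h]),
        R.evList_of_length _ (l := [w, x, y]) rfl, cupCochain, mul_comm, Simp.front, Simp.back,
        R.restr, R.restr]
      congr 3
      · ext1 j
        subst h
        fin_cases j <;> simp [List.getElem_append]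
      · ext1 j
        have hj := j.2
        simp only [Function.comp, List.get_eq_getElem, Fin.val_cast]
        rw [List.getElem_append_left (by simp; omega), List.getElem_append_left (by simp; omega)]
    · rw [R.evList_of_length_ne _ (l := l ++ [w] ++ [x] ++ [y]) (by simpa using h),
        R.evList_of_length_ne _ (l := l ++ [w]) (by simpa using h), mul_zero]
  rw [mul_comm]
  exact LinearMap.congr_fun this c

/-- The beginning of the shuffle product before its last vertex. -/
theorem exists_ez_eq_snoc (p q : ℕ) : ∃ c, ez F (p + 1) (q + 1) = snoc (p, q) c :=
  ⟨(-1 : F) ^ q • ez F p (q + 1) + ez F (p + 1) q, by rw [ez_succ_succ, map_add, map_smul]⟩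

theorem Realization.ev_cupCochain_ez {m k : ℕ} (R : Realization (ℕ × ℕ) X) (h : m + 2 = k)
    (f : Cochain m X F) (g : Cochain 2 X F) (p q : ℕ) (x y : ℕ × ℕ) :
    R.ev (cupCochain h f g) (snoc y (snoc x (ez F (p + 1) (q + 1)))) =
      R.ev f (ez F (p + 1) (q + 1)) * R.evList g [(p, q), x, y] := by
  obtain ⟨c, hc⟩ := exists_ez_eq_snoc (F := F) p q
  rw [hc, R.ev_cupCochain]

/-- The difference of the pullbacks of a cochain under the two projections. -/
def diffCochain {k : ℕ} (f : Cochain k X F) : Cochain k (X × X) F :=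
  pullCochain k ContinuousMap.snd f - pullCochain k ContinuousMap.fst f

theorem evList_diffCochain {p q : ℕ} (σ : Simp p X) (τ : Simp q X) (f : Cochain 2 X F)
    (w x y : ℕ × ℕ) : (prodRealization σ τ).evList (diffCochain f) [w, x, y] =
      f (τ.restr ![clamp q w.2, clamp q x.2, clamp q y.2]) -
        f (σ.restr ![clamp p w.1, clamp p x.1, clamp p y.1]) := by
  rw [Realization.evList_of_length _ _ rfl]
  change f (τ.restr _) - f (σ.restr _) = _
  congr 3 <;> ext j <;> fin_cases j <;> rfl

/-- Each factor sees two consecutive steps of a lattice path. If one is horizontal and the other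
vertical, both projections are degenerate and the factor is zero by normalization. The surviving
paths consist of double steps, `a` horizontal and `b` vertical, so there are `m.choose a` of them.
Shuffling blocks of even length costs no sign, and each horizontal block contributes `-1` from the
difference. -/
theorem ev_cupSeq_diffCochain {p q : ℕ} (σ : Simp p X) (τ : Simp q X) {f : Cochain 2 X F}
    (hf : Normalized f) (m a b : ℕ) (hab : a + b = m) :
    (prodRealization σ τ).ev (cupSeq (fun _ => diffCochain f) m) (ez F (2 * a + 1) (2 * b + 1)) =
      (-1) ^ a * (m.choose a : F) * cupSeq (fun _ => f) a (σ.restr fun j => clamp p j) *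
        cupSeq (fun _ => f) b (τ.restr fun j => clamp q j) := by
  have hσ : ∀ a, cupSeq (fun _ => f) (a + 1) (σ.restr fun j => clamp p j) =
      cupSeq (fun _ => f) a (σ.restr fun j => clamp p j) *
        f (σ.restr ![clamp p (2 * a), clamp p (2 * a + 1), clamp p (2 * a + 1 + 1)]) := by
    intro a
    rw [cupSeq_succ, cupCochain, Simp.front, Simp.back, Simp.restr_restr, Simp.restr_restr]
    congr 3
    ext j
    fin_cases j <;> rfl
  have hτ : ∀ b, cupSeq (fun _ => f) (b + 1) (τ.restr fun j => clamp q j) =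
      cupSeq (fun _ => f) b (τ.restr fun j => clamp q j) *
        f (τ.restr ![clamp q (2 * b), clamp q (2 * b + 1), clamp q (2 * b + 1 + 1)]) := by
    intro b
    rw [cupSeq_succ, cupCochain, Simp.front, Simp.back, Simp.restr_restr, Simp.restr_restr]
    congr 3
    ext j
    fin_cases j <;> rfl
  have hz : ∀ {r : ℕ} (ρ : Simp r X) (i j k : Fin (r + 1)), i = j ∨ j = k →
      f (ρ.restr ![i, j, k]) = 0 := fun ρ i j k h => hf.restr_eq_zero ρ _ h
  induction m generalizing a b with
  | zero =>
    obtain ⟨rfl, rfl⟩ : a = 0 ∧ b = 0 := by omega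
    simp [ez_succ_succ, ez_zero_left, ez_one_zero, Realization.ev_single,
      Realization.evList_of_length, cupSeq]
  | succ m ih =>
    rcases a with _ | a <;> rcases b with _ | b
    · omega
    · have e : ez F (2 * 0 + 1) (2 * (b + 1) + 1) = snoc (0, 2 * b + 1 + 1) (snoc (0, 2 * b + 1)
          (ez F (2 * 0 + 1) (2 * b + 1))) := by
        rw [show 2 * (b + 1) = 2 * b + 1 + 1 by ring, ez_succ_succ, mul_zero, ez_zero_left,
          ez_succ_succ, ez_zero_left]
        simp
      rw [e, cupSeq_succ, Realization.ev_cupCochain_ez, ih 0 b (by omega), evList_diffCochain,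
        hz σ _ _ _ (Or.inl rfl), hτ]
      simp
      ring
    · have e : ez F (2 * (a + 1) + 1) (2 * 0 + 1) = snoc (2 * a + 1 + 1, 0) (snoc (2 * a + 1, 0)
          (ez F (2 * a + 1) (2 * 0 + 1))) := by
        rw [show 2 * (a + 1) = 2 * a + 1 + 1 by ring, ez_succ_succ, mul_zero, ez_add_two_zero,
          ez_succ_succ, ez_add_two_zero]
        simp
      rw [e, cupSeq_succ, Realization.ev_cupCochain_ez, ih a 0 (by omega), evList_diffCochain,
        hz τ _ _ _ (Or.inl rfl), hσ]
      obtain rfl : m = a := by omega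
      simp [pow_succ]
      ring
    -- Paths are sorted by their last two steps: the outer terms are the double steps, which give
    -- Pascal's recursion, and the two middle ones are mixed and vanish.
    · have e : ez F (2 * (a + 1) + 1) (2 * (b + 1) + 1) =
          snoc (2 * a + 1 + 1, 2 * b + 1 + 1) (snoc (2 * a + 1, 2 * b + 1 + 1)
            (ez F (2 * a + 1) (2 * (b + 1) + 1))) +
          snoc (2 * a + 1 + 1, 2 * b + 1 + 1) (snoc (2 * a + 1, 2 * b + 1 + 1)
            (ez F (2 * a + 1 + 1) (2 * b + 1 + 1))) +
          (- snoc (2 * a + 1 + 1, 2 * b + 1 + 1) (snoc (2 * a + 1 + 1, 2 * b + 1)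
            (ez F (2 * a + 1 + 1) (2 * b + 1 + 1))) +
          snoc (2 * a + 1 + 1, 2 * b + 1 + 1) (snoc (2 * a + 1 + 1, 2 * b + 1)
            (ez F (2 * (a + 1) + 1) (2 * b + 1)))) := by
        rw [show 2 * (a + 1) = 2 * a + 1 + 1 by ring, show 2 * (b + 1) = 2 * b + 1 + 1 by ring,
          ez_succ_succ, ez_succ_succ (2 * a + 1), ez_succ_succ (2 * a + 1 + 1) (2 * b + 1)]
        simp [pow_succ, pow_mul]
      rw [e, cupSeq_succ, map_add, map_add, map_add, map_neg]
      simp only [Realization.ev_cupCochain_ez]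
      rw [ih a (b + 1) (by omega), ih (a + 1) b (by omega)]
      simp only [evList_diffCochain]
      have ha2 : clamp p (2 * (a + 1)) = clamp p (2 * a + 1 + 1) := rfl
      have hb2 : clamp q (2 * (b + 1)) = clamp q (2 * b + 1 + 1) := rfl
      rw [ha2, hb2, hz τ (clamp q (2 * b + 1 + 1)) _ _ (Or.inl rfl), hz σ (clamp p (2 * a + 1 + 1)) _ _ (Or.inl rfl),
        hz σ _ (clamp p (2 * a + 1)) _ (Or.inl rfl), hz τ _ (clamp q (2 * b + 1 + 1)) _ (Or.inr rfl),
        hz σ _ (clamp p (2 * a + 1 + 1)) _ (Or.inr rfl), hz τ _ (clamp q (2 * b + 1)) _ (Or.inl rfl),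
        hσ, hτ]
      rw [Nat.choose_succ_succ]
      push_cast
      ring

theorem ezEval_cupSeq_diffCochain {n : ℕ} (σ τ : Simp (2 * n) X) {f : Cochain 2 X F}
    (hf : Normalized f) : ezEval (cupSeq (fun _ => diffCochain f) (2 * n)) σ τ =
      (-1) ^ n * ((2 * n).choose n : F) * (cupSeq (fun _ => f) n σ * cupSeq (fun _ => f) n τ) := by
  have h : ∀ ρ : Simp (2 * n) X, (ρ.restr fun j => clamp (2 * n) j) = ρ := by
    intro ρ
    have : (fun j : Fin (2 * n + 1) => clamp (2 * n) j) = id := by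
      ext j
      simp [clamp]
      omega
    rw [this]
    ext x
    simp [Simp.restr]
  rw [ezEval, ev_cupSeq_diffCochain σ τ hf (2 * n) n n (by omega), h, h, mul_assoc]

end Evaluation

/-! ### The cross product of chains -/

section Cross

variable {A X Y F : Type*} [TopologicalSpace X] [TopologicalSpace Y] [Field F]

/-- The singular chain given by a chain of tuples. -/
def Realization.toChain (R : Realization A X) (k : ℕ) : (List A →₀ F) →ₗ[F] (Simp k X →₀ F) :=
  Finsupp.linearCombination F fun l =>
    if h : l.length = k + 1 then Finsupp.single (R.simp k fun j => l.get (Fin.cast h.symm j)) 1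
    else 0

theorem Realization.pairing_toChain {k : ℕ} (R : Realization A X) (f : Cochain k X F)
    (c : List A →₀ F) : pairing f (R.toChain k c) = R.ev f c := by
  have : pairing f ∘ₗ R.toChain k = R.ev f := by
    apply TupleChain.hom_ext
    intro l
    rw [LinearMap.comp_apply, ev_single, toChain, Finsupp.linearCombination_single, evList]
    split_ifs with h
    · rw [one_smul, pairing_single]
    · simp
  exact LinearMap.congr_fun this c

/-- The cross product of two singular chains. -/
def cross (k : ℕ) {p q : ℕ} (z : Simp p X →₀ F) (w : Simp q Y →₀ F) : Simp k (X × Y) →₀ F :=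
  z.sum fun σ a => w.sum fun τ b =>
    (a * b) • (prodRealization σ τ).toChain k (ez F (p + 1) (q + 1))

theorem pairing_cross {k p q : ℕ} (f : Cochain k (X × Y) F) (z : Simp p X →₀ F)
    (w : Simp q Y →₀ F) :
    pairing f (cross k z w) = z.sum fun σ a => w.sum fun τ b => a * b * ezEval f σ τ := by
  simp only [cross, Finsupp.sum, map_sum, map_smul, Realization.pairing_toChain, smul_eq_mul,
    ezEval]

/-- With one simplex fixed, `ezEval g` is a cochain in the other, so both terms of the Leibniz rule
are sums of coboundaries evaluated on `z` or on `w`. -/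
theorem isCycle_cross {k p q : ℕ} {z : Simp (p + 1) X →₀ F} {w : Simp (q + 1) Y →₀ F}
    (hz : IsCycle z) (hw : IsCycle w) : IsCycle (cross (k + 1) z w) := by
  intro g
  rw [pairing_cross]
  have h1 : ∀ τ : Simp (q + 1) Y, z.sum (fun σ a => a * ∑ i : Fin (p + 2), (-1) ^ (i : ℕ) * ezEval g (σ.face i) τ)
      = 0 := by
    intro τ
    have := hz fun σ => ezEval g σ τ
    simpa [pairing, Finsupp.linearCombination_apply, coboundary] using this
  have h2 : ∀ σ : Simp (p + 1) X, w.sum (fun τ b => b * ∑ i : Fin (q + 2), (-1) ^ (i : ℕ) * ezEval g σ (τ.face i))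
      = 0 := by
    intro σ
    have := hw fun τ => ezEval g σ τ
    simpa [pairing, Finsupp.linearCombination_apply, coboundary] using this
  simp only [ezEval_coboundary]
  simp only [Finsupp.sum, mul_add, Finset.sum_add_distrib] at h1 h2 ⊢
  rw [Finset.sum_comm]
  have e1 : ∀ τ ∈ w.support, ∑ σ ∈ z.support, z σ * w τ *
      ∑ i : Fin (p + 2), (-1) ^ (i : ℕ) * ezEval g (σ.face i) τ = 0 := by
    intro τ _
    rw [Finset.sum_congr rfl fun σ _ => by rw [mul_comm (z σ), mul_assoc], ← Finset.mul_sum, h1,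
      mul_zero]
  have e2 : ∀ σ ∈ z.support, ∑ τ ∈ w.support, z σ * w τ *
      ((-1) ^ (p + 1) * ∑ i : Fin (q + 2), (-1) ^ (i : ℕ) * ezEval g σ (τ.face i)) = 0 := by
    intro σ _
    rw [Finset.sum_congr rfl fun τ _ => by rw [mul_assoc, mul_left_comm (w τ)], ← Finset.mul_sum,
      ← Finset.mul_sum, h2, mul_zero, mul_zero]
  rw [Finset.sum_eq_zero e1, Finset.sum_eq_zero e2, add_zero]

end Cross

/-! ### The standard edge -/

section Edge

variable {X Y F : Type*} [TopologicalSpace X] [TopologicalSpace Y] [Field F]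

/-- The unit interval as a singular simplex. -/
def edge : Simp 1 unitInterval := ⟨stdSimplexHomeomorphUnitInterval, stdSimplexHomeomorphUnitInterval.continuous⟩

theorem edge_coe (t : stdSimplex ℝ (Fin 2)) : (edge t : ℝ) = t 1 := rfl

theorem edge_face_zero (x : stdSimplex ℝ (Fin 1)) : edge.face 0 x = 1 := by
  have hx : x = stdSimplex.vertex (S := ℝ) 0 := Subsingleton.elim _ _
  simp only [Simp.face, Simp.restr, ContinuousMap.comp_apply, ContinuousMap.coe_mk, hx,
    stdSimplex.map_vertex]
  exact stdSimplexHomeomorphUnitInterval_one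

theorem edge_face_one (x : stdSimplex ℝ (Fin 1)) : edge.face 1 x = 0 := by
  have hx : x = stdSimplex.vertex (S := ℝ) 0 := Subsingleton.elim _ _
  simp only [Simp.face, Simp.restr, ContinuousMap.comp_apply, ContinuousMap.coe_mk, hx,
    stdSimplex.map_vertex]
  exact stdSimplexHomeomorphUnitInterval_zero

theorem exists_comp_edge (τ : Simp 1 X) : ∃ p : C(unitInterval, X), τ = p.comp edge :=
  ⟨τ.comp ⟨stdSimplexHomeomorphUnitInterval.symm, stdSimplexHomeomorphUnitInterval.symm.continuous⟩,
    by ext x; simp [edge]⟩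

theorem comp_face {k : ℕ} (φ : C(X, Y)) (σ : Simp (k + 1) X) (i : Fin (k + 2)) :
    Simp.face (φ.comp σ) i = φ.comp (σ.face i) := rfl

theorem ez_succ_one (p : ℕ) :
    ez F (p + 1) 1 = Finsupp.single ((List.range (p + 1)).map fun i => (i, 0)) 1 := by
  induction p with
  | zero => simp [ez_succ_succ, ez_zero_left, ez_one_zero]
  | succ p ih =>
    rw [ez_succ_succ, ih, ez_add_two_zero, List.range_succ (n := p + 1)]
    simp

theorem ezEval_point {p : ℕ} (f : Cochain p (X × Y) F) (σ : Simp p X) (τ : Simp 0 Y) (y : Y)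
    (hτ : ∀ x, τ x = y) : ezEval f σ τ = f (σ.prodMk (ContinuousMap.const _ y)) := by
  have hl : ((List.range (p + 1)).map fun i => (i, 0)).length = p + 1 := by simp
  rw [ezEval, ez_succ_one, Realization.ev_single, one_mul, Realization.evList_of_length _ _ hl]
  congr 1
  ext1 x
  refine Prod.ext ?_ (hτ _)
  have : (fun j => clamp p (((List.range (p + 1)).map fun i => (i, 0)).get (Fin.cast hl.symm j)).1) =
      id := by
    ext j
    have := j.2
    simp [clamp]
    omega
  change σ.restr (fun j => clamp p (((List.range (p + 1)).map fun i => (i, 0)).get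
    (Fin.cast hl.symm j)).1) x = σ x
  rw [this]
  simp [Simp.restr]

end Edge

/-! ### Cocycles of degree one -/

section DegreeOne

variable {W F : Type*} [TopologicalSpace W] [Field F]

theorem coboundary_zero_apply (g : Cochain 0 W F) (σ : Simp 1 W) :
    coboundary 0 W F g σ = g (σ.face 0) - g (σ.face 1) := by
  change ∑ i : Fin 2, (-1) ^ (i : ℕ) * g (σ.face i) = _
  rw [Fin.sum_univ_two]
  simp
  ring

/-- The value of a cochain on a path. -/
def onPath (β : Cochain 1 W F) {x y : W} (p : Path x y) : F := β (p.toContinuousMap.comp edge)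

/-- The cocycle condition on the degenerate triangle with vertices `0`, `1/2`, `1` in the interval,
mapped by the concatenated path. -/
theorem onPath_trans {β : Cochain 1 W F} (hβ : β ∈ Cocycles 1 W F) {x y z : W} (p : Path x y)
    (q : Path y z) : onPath β (p.trans q) = onPath β p + onPath β q := by
  let R := affineRealization (convex_Icc (0 : ℝ) 1) (p.trans q).toContinuousMap
  let h : unitInterval := ⟨1 / 2, by norm_num, by norm_num⟩
  have key := R.ev_coboundary β (Finsupp.single [0, h, 1] 1)
  have h0 : R.ev (coboundary 1 W F β) (Finsupp.single [0, h, 1] 1) = 0 := by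
    rw [Realization.ev_single, Realization.evList_of_length _ _ rfl, LinearMap.mem_ker.1 hβ]
    simp
  have e1 : ∀ a b : unitInterval, R.evList β [a, b] =
      β ((p.trans q).toContinuousMap.comp (affineSimp (convex_Icc (0 : ℝ) 1) ![a, b])) := by
    intro a b
    rw [Realization.evList_of_length _ _ rfl]
    change β ((p.trans q).toContinuousMap.comp (affineSimp (convex_Icc (0 : ℝ) 1) _)) = _
    congr 3
    ext j
    fin_cases j <;> rfl
  have h1 : (p.trans q).toContinuousMap.comp (affineSimp (convex_Icc (0 : ℝ) 1) ![0, h]) =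
      p.toContinuousMap.comp edge := by
    ext t
    change (p.trans q) (affineSimp _ ![0, h] t) = p (edge t)
    have ht : (affineSimp (convex_Icc (0 : ℝ) 1) ![0, h] t : ℝ) = t 1 / 2 := by
      simp [affineSimp, Fin.sum_univ_two, h]
      ring
    have := stdSimplex.le_one t 1
    rw [Path.trans_apply, dif_pos (by rw [ht]; linarith)]
    congr 1
    ext
    rw [edge_coe]
    simp only [ht]
    ring
  have h2 : (p.trans q).toContinuousMap.comp (affineSimp (convex_Icc (0 : ℝ) 1) ![h, 1]) =
      q.toContinuousMap.comp edge := by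
    ext t
    change (p.trans q) (affineSimp _ ![h, 1] t) = q (edge t)
    have ht : (affineSimp (convex_Icc (0 : ℝ) 1) ![h, 1] t : ℝ) = (1 + t 1) / 2 := by
      have := stdSimplex.add_eq_one t
      simp [affineSimp, Fin.sum_univ_two, h]
      linarith
    have h0 := stdSimplex.zero_le t 1
    have hq : q (edge t) = q ⟨2 * (affineSimp (convex_Icc (0 : ℝ) 1) ![h, 1] t : ℝ) - 1, by
        rw [ht]; have := stdSimplex.le_one t 1; constructor <;> linarith⟩ := by
      congr 1
      ext
      rw [edge_coe]
      simp only [ht]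
      ring
    rw [hq, Path.trans_apply]
    split_ifs with hle
    · have ht0 : (affineSimp (convex_Icc (0 : ℝ) 1) ![h, 1] t : ℝ) = 1 / 2 := by
        rw [ht] at hle ⊢
        linarith
      simp only [ht0]
      norm_num
    · rfl
  have h3 : (p.trans q).toContinuousMap.comp (affineSimp (convex_Icc (0 : ℝ) 1) ![0, 1]) =
      (p.trans q).toContinuousMap.comp edge := by
    congr 1
    ext t
    rw [edge_coe]
    simp [affineSimp, Fin.sum_univ_two]
  rw [h0, TupleChain.bd_single] at key
  simp only [TupleChain.bdList, map_zero, sub_zero, map_sub, Finsupp.lmapDomain_apply,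
    Finsupp.mapDomain_single, Realization.ev_single, one_mul, e1, h1, h2, h3] at key
  simp only [onPath]
  linear_combination key

/-- The primitive at `w` is the value of `β` on a path to `w` from a base point `r w` chosen in each
path component; vanishing on loops makes it independent of the path. -/
theorem exists_coboundary_of_loops {β : Cochain 1 W F} (hβ : β ∈ Cocycles 1 W F)
    (h : ∀ p : C(unitInterval, W), p 0 = p 1 → β (p.comp edge) = 0) :
    ∃ g : Cochain 0 W F, β = coboundary 0 W F g := by
  let r : W → W := fun w => (Quotient.mk (pathSetoid W) w).out
  have hr : ∀ w, Joined (r w) w := fun w =>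
    Quotient.exact (s := pathSetoid W) (Quotient.out_eq (s := pathSetoid W) _)
  have h' : ∀ {x : W} (p : Path x x), onPath β p = 0 := fun p => h p.toContinuousMap (by simp)
  have hs : ∀ {x y : W} (p : Path x y), onPath β p.symm = - onPath β p := by
    intro x y p
    have := onPath_trans hβ p p.symm
    rw [h'] at this
    linear_combination - this
  let c : W → F := fun w => onPath β (hr w).somePath
  refine ⟨fun ρ => c (ρ (stdSimplex.vertex (S := ℝ) 0)), ?_⟩
  ext τ
  obtain ⟨p, rfl⟩ := exists_comp_edge τ
  rw [coboundary_zero_apply, comp_face, comp_face]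
  simp only [ContinuousMap.comp_apply, edge_face_zero, edge_face_one]
  let P : Path (p 0) (p 1) := ⟨p, rfl, rfl⟩
  have hP : r (p 0) = r (p 1) := by
    have : Quotient.mk (pathSetoid W) (p 0) = Quotient.mk (pathSetoid W) (p 1) :=
      Quotient.sound ⟨P⟩
    simp only [r, this]
  have key : ∀ {a b : W} (hab : a = b) (e : Path a (p 0)) (e' : Path b (p 1)),
      onPath β P = onPath β e' - onPath β e := by
    intro a b hab e e'
    subst hab
    have := h' ((e.trans P).trans e'.symm)
    rw [onPath_trans hβ, onPath_trans hβ, hs] at this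
    linear_combination this
  exact key hP _ _

end DegreeOne

/-! ### Loops and tori -/

section Torus

variable {X W F : Type*} [TopologicalSpace X] [TopologicalSpace W] [Field F]

/-- The loop winding once around the circle. -/
def winding : C(unitInterval, Circle) := ⟨fun t => Circle.exp (2 * Real.pi * t), by fun_prop⟩

/-- The upper half of the circle. -/
def upperArc : C(unitInterval, Circle) := ⟨fun t => Circle.exp (Real.pi * t), by fun_prop⟩

/-- The lower half of the circle. -/
def lowerArc : C(unitInterval, Circle) := ⟨fun t => Circle.exp (- (Real.pi * t)), by fun_prop⟩

theorem winding_zero : winding 0 = 1 := by simp [winding]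

theorem winding_one : winding 1 = 1 := by simp [winding]

theorem lowerArc_zero : lowerArc 0 = upperArc 0 := by simp [lowerArc, upperArc]

theorem lowerArc_one : lowerArc 1 = upperArc 1 := by
  ext
  simp [lowerArc, upperArc]

theorem winding_surjective : Function.Surjective winding := by
  intro z
  obtain ⟨x, rfl⟩ := Circle.exp_surjective z
  have hpi := Real.two_pi_pos
  refine ⟨⟨Int.fract (x / (2 * Real.pi)), Int.fract_nonneg _, (Int.fract_lt_one _).le⟩, ?_⟩
  refine Circle.exp_eq_exp.2 ⟨-⌊x / (2 * Real.pi)⌋, ?_⟩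
  simp only [Int.fract]
  push_cast
  field_simp
  ring

theorem exists_comp_winding (p : C(unitInterval, W)) (hp : p 0 = p 1) :
    ∃ γ : C(Circle, W), γ.comp winding = p := by
  have hq : IsQuotientMap winding :=
    winding.continuous.isClosedMap.isQuotientMap winding.continuous winding_surjective
  refine ⟨hq.lift p ?_, hq.lift_comp _ _⟩
  intro a b hab
  obtain ⟨m, hm⟩ := Circle.exp_eq_exp.1 hab
  have hpi := Real.two_pi_pos
  have hm' : (a : ℝ) = b + m := by
    have : 2 * Real.pi * ((a : ℝ) - (b + m)) = 0 := by linear_combination hm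
    rcases mul_eq_zero.1 this with h | h
    · exact absurd h hpi.ne'
    · linarith
  have ha := a.2
  have hb := b.2
  have h1 : (-1 : ℝ) ≤ m := by linarith [ha.1, hb.2]
  have h2 : (m : ℝ) ≤ 1 := by linarith [ha.2, hb.1]
  have h1' : -1 ≤ m := by exact_mod_cast h1
  have h2' : m ≤ 1 := by exact_mod_cast h2
  obtain rfl | rfl | rfl : m = -1 ∨ m = 0 ∨ m = 1 := by omega
  · have e1 : a = 0 := Subtype.ext (by push_cast at hm'; change (a : ℝ) = 0; linarith [ha.1, hb.2])
    have e2 : b = 1 := Subtype.ext (by push_cast at hm'; change (b : ℝ) = 1; linarith [ha.1, hb.2])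
    rw [e1, e2, hp]
  · have e1 : a = b := Subtype.ext (by simpa using hm')
    rw [e1]
  · have e1 : a = 1 := Subtype.ext (by push_cast at hm'; change (a : ℝ) = 1; linarith [ha.2, hb.1])
    have e2 : b = 0 := Subtype.ext (by push_cast at hm'; change (b : ℝ) = 0; linarith [ha.2, hb.1])
    rw [e1, e2, hp]

/-- The height of a point of the circle, measured from `1` to `-1`. -/
def height : C(Circle, unitInterval) :=
  ⟨fun z => ⟨(1 - (z : ℂ).re) / 2, by
    have := Complex.abs_re_le_norm (z : ℂ)
    rw [Circle.norm_coe, abs_le] at this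
    constructor <;> linarith⟩, by fun_prop⟩

/-- A parametrization of the unit interval by half a circle. -/
def cosParam : C(unitInterval, unitInterval) := height.comp upperArc

theorem height_lowerArc (t : unitInterval) : height (lowerArc t) = cosParam t := by
  ext
  simp only [cosParam, height, lowerArc, upperArc, Circle.coe_exp, ContinuousMap.comp_apply,
    ContinuousMap.coe_mk, Complex.exp_ofReal_mul_I_re, Real.cos_neg]

theorem cosParam_zero : cosParam 0 = 0 := by
  ext
  simp [cosParam, height, upperArc]

theorem cosParam_one : cosParam 1 = 1 := by
  ext
  simp [cosParam, height, upperArc]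

theorem im_upperArc (t : unitInterval) : 0 ≤ (upperArc t : ℂ).im := by
  simp only [upperArc, ContinuousMap.coe_mk, Circle.coe_exp, Complex.exp_ofReal_mul_I_im]
  have := t.2
  exact Real.sin_nonneg_of_nonneg_of_le_pi (by have := Real.pi_pos; nlinarith [this, t.2.1])
    (by have := Real.pi_pos; nlinarith [this, t.2.2])

theorem im_lowerArc (t : unitInterval) : (lowerArc t : ℂ).im ≤ 0 := by
  have := im_upperArc t
  simp only [upperArc, lowerArc, ContinuousMap.coe_mk, Circle.coe_exp,
    Complex.exp_ofReal_mul_I_im, Real.sin_neg] at this ⊢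
  linarith

/-- Two families of paths with the same end points form a family of circles. -/
theorem exists_family_of_circles (s s' : C(W, C(unitInterval, X))) (h0 : ∀ w, s w 0 = s' w 0)
    (h1 : ∀ w, s w 1 = s' w 1) : ∃ φ : C(W × Circle, X),
      (∀ w t, φ (w, upperArc t) = s w (cosParam t)) ∧
        ∀ w t, φ (w, lowerArc t) = s' w (cosParam t) := by
  -- The two arcs meet only at `1` and `-1`, of heights `0` and `1`, where the paths share their end
  -- points.
  have hb : ∀ (w : W) (z : Circle), (z : ℂ).im = 0 → s w (height z) = s' w (height z) := by
    intro w z hz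
    have h2 : (z : ℂ).re * (z : ℂ).re = 1 := by
      have := Circle.normSq_coe z
      rw [Complex.normSq_apply, hz] at this
      simpa using this
    rcases mul_self_eq_one_iff.1 h2 with h | h
    · have : height z = 0 := by ext; simp [height, h]
      rw [this, h0]
    · have : height z = 1 := by ext; simp [height, h]
      rw [this, h1]
  refine ⟨⟨fun w => if 0 ≤ (w.2 : ℂ).im then s w.1 (height w.2) else s' w.1 (height w.2), ?_⟩,
    fun w t => ?_, fun w t => ?_⟩
  · refine Continuous.if_le ?_ ?_ continuous_const (by fun_prop) fun w hw => hb _ _ hw.symm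
    · fun_prop
    · fun_prop
  · simp [im_upperArc, cosParam]
  · simp only [ContinuousMap.coe_mk]
    split_ifs with h
    · rw [hb _ _ (le_antisymm (im_lowerArc t) h), height_lowerArc]
    · rw [height_lowerArc]

end Torus

/-! ### Motion planners and atoroidal classes -/

section Planner

variable {X F : Type*} [TopologicalSpace X] [Field F]

/-- The homotopy given by a family of paths, reparametrized by the cosine. -/
def familyHomotopy {W : Type*} [TopologicalSpace W] (s : C(W, C(unitInterval, X))) :
    C(W × unitInterval, X) :=
  ⟨fun z => s z.1 (cosParam z.2), by fun_prop⟩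

/-- The cochain obtained by integrating a cochain of degree two along a family of paths. -/
def transgression {W : Type*} [TopologicalSpace W] (s : C(W, C(unitInterval, X)))
    (f : Cochain 2 X F) : Cochain 1 W F :=
  fun τ => ezEval (pullCochain 2 (familyHomotopy s) f) τ edge

/-- Stokes on `σ × [0,1]`: since `f` is closed, the integral over the side faces cancels the
difference of the values at the two ends. -/
theorem coboundary_transgression {W : Type*} [TopologicalSpace W] (s : C(W, C(unitInterval, X)))
    {f : Cochain 2 X F} (hf : f ∈ Cocycles 2 X F) (φ : C(W, X × X))
    (h0 : ∀ w, s w 0 = (φ w).1) (h1 : ∀ w, s w 1 = (φ w).2) (σ : Simp 2 W) :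
    coboundary 1 W F (transgression s f) σ = - diffCochain f (φ.comp σ) := by
  have key := ezEval_coboundary (pullCochain 2 (familyHomotopy s) f) σ edge
  rw [coboundary_pullCochain, LinearMap.mem_ker.1 hf, map_zero] at key
  have hz : ezEval (0 : Cochain 3 (W × unitInterval) F) σ edge = 0 := by
    have := (prodRealization σ edge).ev_smul (0 : F) (0 : Cochain 3 (W × unitInterval) F)
      (ez F 3 2)
    rw [zero_smul, zero_mul] at this
    exact this
  have e : ∀ b : Fin 2, ∀ t, (∀ x, edge.face b x = t) →
      ezEval (pullCochain 2 (familyHomotopy s) f) σ (edge.face b) =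
        f ((familyHomotopy s).comp (σ.prodMk (ContinuousMap.const _ t))) := fun b t hb =>
    ezEval_point _ σ _ t hb
  have h2 : ∑ b : Fin 2, (-1) ^ (b : ℕ) *
      ezEval (pullCochain 2 (familyHomotopy s) f) σ (edge.face b) = diffCochain f (φ.comp σ) := by
    rw [Fin.sum_univ_two, e 0 1 edge_face_zero, e 1 0 edge_face_one]
    have a1 : (familyHomotopy s).comp (σ.prodMk (ContinuousMap.const _ 1)) =
        ContinuousMap.snd.comp (φ.comp σ) := by
      ext x
      simp [familyHomotopy, cosParam_one, h1]
    have a0 : (familyHomotopy s).comp (σ.prodMk (ContinuousMap.const _ 0)) =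
        ContinuousMap.fst.comp (φ.comp σ) := by
      ext x
      simp [familyHomotopy, cosParam_zero, h0]
    rw [a1, a0, diffCochain, Pi.sub_apply, Fin.val_zero, Fin.val_one, pow_zero, pow_one, one_mul,
      neg_one_mul, ← sub_eq_add_neg]
    rfl
  change ∑ a : Fin 3, (-1) ^ (a : ℕ) *
    ezEval (pullCochain 2 (familyHomotopy s) f) (σ.face a) edge = _
  rw [← h2]
  refine eq_neg_of_add_eq_zero_left ?_
  rw [hz] at key
  simpa using key.symm

theorem ezEval_coboundary_square {Y Z : Type*} [TopologicalSpace Y] [TopologicalSpace Z]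
    (g : Cochain 1 (Y × Z) F) (σ : Simp 1 Y) (τ : Simp 1 Z) :
    ezEval (coboundary 1 (Y × Z) F g) σ τ =
      (ezEval g (σ.face 0) τ - ezEval g (σ.face 1) τ) -
        (ezEval g σ (τ.face 0) - ezEval g σ (τ.face 1)) := by
  refine (ezEval_coboundary g σ τ).trans ?_
  change ∑ a : Fin 2, (-1) ^ (a : ℕ) * ezEval g (σ.face a) τ +
    (-1) ^ 1 * ∑ b : Fin 2, (-1) ^ (b : ℕ) * ezEval g σ (τ.face b) = _
  rw [Fin.sum_univ_two, Fin.sum_univ_two]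
  simp only [Fin.val_zero, Fin.val_one]
  ring

/-- Over a loop the two families glue to a map of the torus, on which `f` pulls back to some `δg`.
The two sides are the values of `δg` on the halves of the torus cut along the second circle. The
boundaries of these halves agree, as the arcs share their end points and the loop is closed, so no
fundamental class of the torus is needed. -/
theorem transgression_loop {W : Type*} [TopologicalSpace W] (s s' : C(W, C(unitInterval, X)))
    (h0 : ∀ w, s w 0 = s' w 0) (h1 : ∀ w, s w 1 = s' w 1) {f : Cochain 2 X F}
    (hf : ∀ φ : C(Circle × Circle, X), pullCochain 2 φ f ∈ Coboundaries (Circle × Circle) F 2)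
    (p : C(unitInterval, W)) (hp : p 0 = p 1) :
    transgression s f (p.comp edge) = transgression s' f (p.comp edge) := by
  obtain ⟨γ, hγ⟩ := exists_comp_winding p hp
  obtain ⟨φ, hφ, hφ'⟩ := exists_family_of_circles s s' h0 h1
  obtain ⟨g, hg⟩ := hf (φ.comp (γ.prodMap (ContinuousMap.id _)))
  have e : transgression s f (p.comp edge) =
      ezEval (coboundary 1 (Circle × Circle) F g) (winding.comp edge) (upperArc.comp edge) := by
    rw [hg, ← ezEval_pull, transgression]
    change ezEval (pullCochain 2 ((familyHomotopy s).comp (p.prodMap (ContinuousMap.id _))) f)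
      edge edge = ezEval (pullCochain 2 ((φ.comp (γ.prodMap (ContinuousMap.id _))).comp
        (winding.prodMap upperArc)) f) edge edge
    congr 3
    ext ⟨x, t⟩
    simp [familyHomotopy, ← hγ, hφ]
  have e' : transgression s' f (p.comp edge) =
      ezEval (coboundary 1 (Circle × Circle) F g) (winding.comp edge) (lowerArc.comp edge) := by
    rw [hg, ← ezEval_pull, transgression]
    change ezEval (pullCochain 2 ((familyHomotopy s').comp (p.prodMap (ContinuousMap.id _))) f)
      edge edge = ezEval (pullCochain 2 ((φ.comp (γ.prodMap (ContinuousMap.id _))).comp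
        (winding.prodMap lowerArc)) f) edge edge
    congr 3
    ext ⟨x, t⟩
    simp [familyHomotopy, ← hγ, hφ']
  rw [e, e', ezEval_coboundary_square, ezEval_coboundary_square]
  have w : Simp.face (winding.comp edge) 0 = Simp.face (winding.comp edge) 1 := by
    ext x
    simp [comp_face, edge_face_zero, edge_face_one, winding_zero, winding_one]
  have l0 : Simp.face (upperArc.comp edge) 0 = Simp.face (lowerArc.comp edge) 0 := by
    ext x
    simp [comp_face, edge_face_zero, lowerArc_one]
  have l1 : Simp.face (upperArc.comp edge) 1 = Simp.face (lowerArc.comp edge) 1 := by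
    ext x
    simp [comp_face, edge_face_one, lowerArc_zero]
  rw [w, l0, l1, sub_self, sub_self]

/-- A simplex with image in a subspace, as a simplex of the subspace. -/
def Simp.cod {Y : Type*} [TopologicalSpace Y] {k : ℕ} {U : Set Y} (σ : Simp k Y)
    (h : ∀ x, σ x ∈ U) : Simp k U := ⟨fun x => ⟨σ x, h x⟩, by fun_prop⟩

/-- Over two sets with motion planners, the difference of the pullbacks of an atoroidal cocycle
becomes a coboundary. -/
theorem exists_cochain_of_hasMotionPlanner {f : Cochain 2 X F} (hf : f ∈ Cocycles 2 X F)
    (hT : ∀ φ : C(Circle × Circle, X), pullCochain 2 φ f ∈ Coboundaries (Circle × Circle) F 2)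
    {U V : Set (X × X)} (hU : HasMotionPlanner U) (hV : HasMotionPlanner V) :
    ∃ B : Cochain 1 (X × X) F, ∀ σ : Simp 2 (X × X), ((∀ x, σ x ∈ U) ∨ ∀ x, σ x ∈ V) →
      (diffCochain f - coboundary 1 (X × X) F B) σ = 0 := by
  classical
  obtain ⟨s, hs⟩ := hU
  obtain ⟨s', hs'⟩ := hV
  let i : C(↥(U ∩ V), U) := ⟨fun z => ⟨z.1, z.2.1⟩, by fun_prop⟩
  let j : C(↥(U ∩ V), V) := ⟨fun z => ⟨z.1, z.2.2⟩, by fun_prop⟩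
  let vU : C(U, X × X) := ⟨Subtype.val, by fun_prop⟩
  let vV : C(V, X × X) := ⟨Subtype.val, by fun_prop⟩
  have hbU := coboundary_transgression s hf vU (fun z => (hs z).1) (fun z => (hs z).2)
  have hbV := coboundary_transgression s' hf vV (fun z => (hs' z).1) (fun z => (hs' z).2)
  -- Both transgressions have coboundary minus the difference cochain, so they differ by a cocycle
  -- on the intersection, which vanishes on loops by `transgression_loop`.
  obtain ⟨g, hg⟩ : ∃ g : Cochain 0 ↥(U ∩ V) F,
      transgression (s.comp i) f - transgression (s'.comp j) f = coboundary 0 _ F g := by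
    apply exists_coboundary_of_loops
    · rw [Cocycles, LinearMap.mem_ker, map_sub, sub_eq_zero]
      ext σ
      rw [coboundary_transgression (s.comp i) hf (vU.comp i) (fun z => (hs _).1)
        (fun z => (hs _).2), coboundary_transgression (s'.comp j) hf (vV.comp j)
        (fun z => (hs' _).1) (fun z => (hs' _).2)]
      rfl
    · intro p hp
      rw [Pi.sub_apply, sub_eq_zero]
      refine transgression_loop _ _ (fun z => ?_) (fun z => ?_) hT p hp
      · exact (hs (i z)).1.trans (hs' (j z)).1.symm
      · exact (hs (i z)).2.trans (hs' (j z)).2.symm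
  -- Extension by zero is harmless at the cochain level: only its values on simplices in `U ∩ V`
  -- enter the matching of `bU` and `bV`.
  let g' : Cochain 0 U F := fun ρ =>
    if h : ∀ x, (ρ x : X × X) ∈ U ∩ V then g (Simp.cod (vU.comp ρ) h) else 0
  let bU : Cochain 1 U F := transgression s f - coboundary 0 U F g'
  let bV : Cochain 1 V F := transgression s' f
  have hbU' : ∀ σ : Simp 2 U, coboundary 1 U F bU σ = - diffCochain f (vU.comp σ) := by
    intro σ
    simp only [bU, map_sub, coboundary_coboundary, sub_zero, hbU]
  have hUV : ∀ (τ : Simp 1 (X × X)) (hτU : ∀ x, τ x ∈ U) (hτV : ∀ x, τ x ∈ V),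
      bU (τ.cod hτU) = bV (τ.cod hτV) := by
    intro τ hτU hτV
    have h := congrFun hg (τ.cod fun x => ⟨hτU x, hτV x⟩)
    have e : coboundary 0 U F g' (τ.cod hτU) =
        coboundary 0 _ F g (τ.cod fun x => ⟨hτU x, hτV x⟩) := by
      rw [coboundary_zero_apply, coboundary_zero_apply]
      have h0 : ∀ b : Fin 2, g' ((τ.cod hτU).face b) =
          g (Simp.face (τ.cod (U := U ∩ V) fun x => ⟨hτU x, hτV x⟩) b) := fun b =>
        dif_pos (fun x => (⟨hτU _, hτV _⟩ : _ ∈ U ∩ V))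
      rw [h0, h0]
    simp only [bU, Pi.sub_apply, e, ← h]
    rw [sub_sub_eq_add_sub, sub_eq_iff_eq_add, add_comm]
    rfl
  let B : Cochain 1 (X × X) F := fun τ =>
    if h : ∀ x, τ x ∈ U then bU (τ.cod h) else if h : ∀ x, τ x ∈ V then bV (τ.cod h) else 0
  have hBU : ∀ (τ : Simp 1 (X × X)) (h : ∀ x, τ x ∈ U), B τ = bU (τ.cod h) := fun τ h => dif_pos h
  have hBV : ∀ (τ : Simp 1 (X × X)) (h : ∀ x, τ x ∈ V), B τ = bV (τ.cod h) := by
    intro τ h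
    by_cases h' : ∀ x, τ x ∈ U
    · rw [hBU τ h', hUV τ h' h]
    · exact (dif_neg h').trans (dif_pos h)
  -- The sign is that of `coboundary_transgression`.
  refine ⟨-B, fun σ hσ => ?_⟩
  rw [map_neg, sub_neg_eq_add, Pi.add_apply, coboundary_one_apply]
  rcases hσ with h | h
  · have := hbU' (σ.cod h)
    rw [coboundary_one_apply] at this
    rw [hBU _ fun x => h _, hBU _ fun x => h _, hBU _ fun x => h _]
    exact (congrArg (diffCochain f σ + ·) this).trans (add_neg_cancel _)
  · have := hbV (σ.cod h)
    rw [coboundary_one_apply] at this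
    rw [hBV _ fun x => h _, hBV _ fun x => h _, hBV _ fun x => h _]
    exact (congrArg (diffCochain f σ + ·) this).trans (add_neg_cancel _)

end Planner

/-! ### The lower bound -/

section LowerBound

variable {X F : Type*} [TopologicalSpace X] [Field F]

theorem diffCochain_mem_cocycles {k : ℕ} {f : Cochain k X F} (hf : f ∈ Cocycles k X F) :
    diffCochain f ∈ Cocycles k (X × X) F :=
  Submodule.sub_mem _ (pullCochain_mem_cocycles k _ hf) (pullCochain_mem_cocycles k _ hf)

theorem natCast_ne_zero_of_lt_ringChar {n m : ℕ} (hF : ringChar F = 0 ∨ n < ringChar F)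
    (hm : m ∣ n.factorial) : (m : F) ≠ 0 := by
  intro h
  rw [ringChar.spec] at h
  rcases hF with h0 | h0
  · rw [h0, zero_dvd_iff] at h
    rw [h, zero_dvd_iff] at hm
    exact n.factorial_ne_zero hm
  · have hp : (ringChar F).Prime := by
      rcases CharP.char_is_prime_or_zero F (ringChar F) with hp | hp
      · exact hp
      · omega
    exact absurd (hp.dvd_factorial.1 (h.trans hm)) (by omega)

theorem pairing_cross_coboundary {Y : Type*} [TopologicalSpace Y] {k p q : ℕ}
    {f : Cochain k (X × Y) F} (hf : f ∈ Coboundaries (X × Y) F k) {z : Simp (p + 1) X →₀ F}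
    {w : Simp (q + 1) Y →₀ F} (hz : IsCycle z) (hw : IsCycle w) :
    pairing f (cross k z w) = 0 := by
  cases k with
  | zero =>
    rw [Coboundaries, Submodule.mem_bot] at hf
    simp [hf, pairing]
  | succ k =>
    obtain ⟨g, rfl⟩ := hf
    exact isCycle_cross hz hw g

theorem pairing_cross_of_small {Y : Type*} [TopologicalSpace Y] {ι : Type*} {U : ι → Set (X × Y)}
    (hU : ∀ i, IsOpen (U i)) (hc : ⋃ i, U i = Set.univ) {k p q : ℕ} (hk : k ≠ 0)
    {f : Cochain k (X × Y) F} (hf : f ∈ Cocycles k (X × Y) F)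
    (hs : ∀ σ : Simp k (X × Y), (∃ i, ∀ x, σ x ∈ U i) → f σ = 0) {z : Simp (p + 1) X →₀ F}
    {w : Simp (q + 1) Y →₀ F} (hz : IsCycle z) (hw : IsCycle w) :
    pairing f (cross k z w) = 0 := by
  obtain ⟨k, rfl⟩ := Nat.exists_eq_succ_of_ne_zero hk
  exact pairing_eq_zero_of_small hU hc hf hs (isCycle_cross hz hw)

theorem pairing_sub {k : ℕ} (f g : Cochain k X F) (z : Simp k X →₀ F) :
    pairing (f - g) z = pairing f z - pairing g z := by
  simp only [pairing, Finsupp.linearCombination_apply, Pi.sub_apply, smul_sub, Finsupp.sum_sub]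

/-- The top power of the difference class is evaluated on `z × z` twice: it is zero through
representatives adapted to the planners, and a nonzero multiple of a square by the shuffle formula.
-/
theorem false_of_planners {n : ℕ} (hn : n ≠ 0) (hF : ringChar F = 0 ∨ 2 * n < ringChar F)
    {u : H 2 X F} (hu : Atoroidal u) (hun : cupPow u n ≠ 0) (U : ℕ → Set (X × X))
    (hUo : ∀ i, IsOpen (U i)) (hUc : ∀ z, ∃ i < 4 * n, z ∈ U i)
    (hUp : ∀ i, HasMotionPlanner (U i)) : False := by
  obtain ⟨n, rfl⟩ := Nat.exists_eq_succ_of_ne_zero hn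
  obtain ⟨⟨f₀, hf₀⟩, rfl⟩ := Submodule.Quotient.mk_surjective _ u
  obtain ⟨f, hf, hfn, hff⟩ := exists_normalized hf₀
  -- Atoroidality passes from `Fin 2 → Circle` to `Circle × Circle` and from `f₀` to its
  -- normalization.
  have hT : ∀ φ : C(Circle × Circle, X),
      pullCochain 2 φ f ∈ Coboundaries (Circle × Circle) F 2 := by
    have h0 : ∀ φ : C(Fin 2 → Circle, X), pullCochain 2 φ f₀ ∈ Coboundaries (Fin 2 → Circle) F 2 :=
      fun φ => by
        have := hu φ
        have h : pull (F := F) 2 φ (Submodule.Quotient.mk ⟨f₀, hf₀⟩) = Submodule.Quotient.mk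
          ⟨pullCochain 2 φ f₀, pullCochain_mem_cocycles 2 φ hf₀⟩ := rfl
        rw [h, Submodule.Quotient.mk_eq_zero] at this
        exact this
    intro φ
    let a : C(Fin 2 → Circle, Circle × Circle) := ⟨fun z => (z 0, z 1), by fun_prop⟩
    let b : C(Circle × Circle, Fin 2 → Circle) := ⟨fun z => ![z.1, z.2], by
      refine continuous_pi fun i => ?_
      fin_cases i
      · exact continuous_fst
      · exact continuous_snd⟩
    have hab : (φ.comp a).comp b = φ := by
      ext z
      simp [a, b]
    have h1 : pullCochain 2 ((φ.comp a).comp b) f₀ ∈ Coboundaries (Circle × Circle) F 2 :=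
      pullCochain_mem_coboundaries 2 b (h0 (φ.comp a))
    rw [hab] at h1
    have h2 := pullCochain_mem_coboundaries 2 φ hff
    rw [map_sub] at h2
    simpa using Submodule.sub_mem _ h1 h2
  have hne : cupSeq (fun _ => f) (n + 1) ∉ Coboundaries X F (2 * (n + 1)) := by
    intro h
    apply hun
    rw [cupPow_mk, Submodule.Quotient.mk_eq_zero]
    have := Submodule.add_mem _ (cupSeq_sub_mem_coboundaries (fun _ => hf₀) (fun _ => hf)
      (fun _ => hff) (n + 1)) h
    rw [sub_add_cancel] at this
    exact this
  obtain ⟨z, hz, hfz⟩ := exists_isCycle_of_notMem (k := 2 * n + 1) hne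
  -- The `i`-th of the `2 * (n + 1)` factors takes care of `U (2 * i)` and `U (2 * i + 1)`, so a
  -- simplex in `U i` is killed by factor `i / 2`.
  choose B hB using fun i => exists_cochain_of_hasMotionPlanner hf hT (hUp (2 * i))
    (hUp (2 * i + 1))
  let g : ℕ → Cochain 2 (X × X) F := fun i => diffCochain f - coboundary 1 (X × X) F (B i)
  have hg : ∀ i, g i ∈ Cocycles 2 (X × X) F := fun i =>
    Submodule.sub_mem _ (diffCochain_mem_cocycles hf) (LinearMap.mem_ker.2 (coboundary_coboundary _))
  have e1 : pairing (cupSeq g (2 * (n + 1))) (cross (2 * (2 * (n + 1))) z z) = 0 := by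
    refine pairing_cross_of_small (U := fun i : Fin (4 * (n + 1)) => U i) (fun i => hUo i) ?_
      (by omega) (cupSeq_mem_cocycles hg _) ?_ hz hz
    · refine Set.eq_univ_of_forall fun x => ?_
      obtain ⟨i, hi, hx⟩ := hUc x
      exact Set.mem_iUnion.2 ⟨⟨i, hi⟩, hx⟩
    · rintro σ ⟨i, hi⟩
      have hi2 := i.2
      refine cupSeq_eq_zero (U := U i) (j := i / 2) (by omega) (fun ρ hρ => hB _ ρ ?_) σ hi
      rcases Nat.mod_two_eq_zero_or_one i with h | h
      · left
        rwa [show 2 * (i.val / 2) = i by omega]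
      · right
        rwa [show 2 * (i.val / 2) + 1 = i by omega]
  have e2 : pairing (cupSeq (fun _ => diffCochain f) (2 * (n + 1)))
      (cross (2 * (2 * (n + 1))) z z) = 0 := by
    have := cupSeq_sub_mem_coboundaries (fun _ => diffCochain_mem_cocycles hf) hg
      (fun i => by
        simp only [g, sub_sub_cancel]
        exact ⟨B i, rfl⟩) (2 * (n + 1))
    have h := pairing_cross_coboundary this hz hz
    rwa [pairing_sub, e1, sub_zero] at h
  have e3 : pairing (cupSeq (fun _ => diffCochain f) (2 * (n + 1)))
      (cross (2 * (2 * (n + 1))) z z) = (-1) ^ (n + 1) * ((2 * (n + 1)).choose (n + 1) : F) *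
        (pairing (cupSeq (fun _ => f) (n + 1)) z * pairing (cupSeq (fun _ => f) (n + 1)) z) := by
    refine (pairing_cross (p := 2 * (n + 1)) (q := 2 * (n + 1)) _ z z).trans ?_
    simp only [ezEval_cupSeq_diffCochain _ _ hfn, pairing, Finsupp.linearCombination_apply,
      Finsupp.sum, smul_eq_mul]
    rw [Finset.sum_mul_sum, Finset.mul_sum]
    refine Finset.sum_congr rfl fun σ _ => ?_
    rw [Finset.mul_sum]
    refine Finset.sum_congr rfl fun τ _ => ?_
    ring
  rw [e2] at e3
  have hc : ((2 * (n + 1)).choose (n + 1) : F) ≠ 0 :=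
    natCast_ne_zero_of_lt_ringChar hF ⟨(n + 1).factorial * (2 * (n + 1) - (n + 1)).factorial, by
      rw [← mul_assoc, Nat.choose_mul_factorial_mul_factorial (by omega)]⟩
  have : (-1 : F) ^ (n + 1) ≠ 0 := by simp
  exact mul_ne_zero (mul_ne_zero this hc) (mul_ne_zero hfz hfz) e3.symm

theorem le_TC {n : ℕ} (hF : ringChar F = 0 ∨ 2 * n < ringChar F)
    {u : H 2 X F} (hu : Atoroidal u) (hun : cupPow u n ≠ 0) : (4 * n : ℕ) ≤ TC X := by
  refine le_iInf₂ fun k ⟨U, hUo, hUc, hUp⟩ => ?_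
  rw [Nat.cast_le]
  by_contra! h
  -- A shorter cover is padded by repeating its last set.
  refine false_of_planners (by omega) hF hu hun (fun i => U ⟨min i k, by omega⟩)
    (fun i => hUo _) (fun z => ?_) fun i => hUp _
  have hz : z ∈ ⋃ i, U i := hUc ▸ Set.mem_univ z
  obtain ⟨i, hi⟩ := Set.mem_iUnion.1 hz
  have hi2 := i.2
  refine ⟨i, by omega, ?_⟩
  convert hi
  omega

end LowerBound

open Metric Set

/-! ### Functions and families of paths on skeleta -/

section Curry

variable {X Z : Type*} [TopologicalSpace X] [TopologicalSpace Z]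

theorem exists_continuousOn_curry [Nonempty X] {D : Set Z} {F : Z × unitInterval → X}
    (hF : ContinuousOn F (D ×ˢ univ)) :
    ∃ s : Z → C(unitInterval, X), ContinuousOn s D ∧ ∀ z ∈ D, ∀ t, s z t = F (z, t) := by
  classical
  have hF' : Continuous fun p : D × unitInterval => F (p.1, p.2) :=
    hF.comp_continuous (by fun_prop) fun p => ⟨p.1.2, trivial⟩
  let s' : C(D, C(unitInterval, X)) := ContinuousMap.curry ⟨_, hF'⟩
  refine ⟨fun z => if h : z ∈ D then s' ⟨z, h⟩ else ContinuousMap.const _ (Classical.arbitrary X),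
    ?_, fun z hz t => by simp [hz, s']⟩
  rw [continuousOn_iff_continuous_domRestrict]
  convert s'.continuous using 1
  ext z t
  simp

theorem continuousOn_if_nonneg {D : Set Z} {f g : Z → X} {s : Z → ℝ} (hf : ContinuousOn f D)
    (hg : ContinuousOn g D) (hs : ContinuousOn s D) (h : ∀ z ∈ D, s z = 0 → f z = g z) :
    ContinuousOn (fun z => if 0 ≤ s z then f z else g z) D := by
  rw [continuousOn_iff_continuous_domRestrict] at *
  exact hf.if_le hg continuous_const hs fun z hz => h z z.2 hz.symm

end Curry

/-! ### Gluing functions along the cells of one dimension -/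

section Skeleton

variable {X : Type*} [TopologicalSpace X] [CWComplex (univ : Set X)]

/-- The characteristic map of a cell. -/
def charMap {k : ℕ} (e : RelCWComplex.cell (univ : Set X) k) : (Fin k → ℝ) → X :=
  RelCWComplex.map k e

variable {k m : ℕ}

theorem continuousOn_charMap (e : RelCWComplex.cell (univ : Set X) k) :
    ContinuousOn (charMap e) (closedBall 0 1) := RelCWComplex.continuousOn k e

theorem charMap_inj {e e' : RelCWComplex.cell (univ : Set X) k} {z z' : Fin k → ℝ}
    (hz : z ∈ ball 0 1) (hz' : z' ∈ ball 0 1) (h : charMap e z = charMap e' z') :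
    (⟨e, z⟩ : RelCWComplex.cell (univ : Set X) k × (Fin k → ℝ)) = ⟨e', z'⟩ := by
  have he := RelCWComplex.eq_of_not_disjoint_openCell (C := (univ : Set X)) (j := e) (i := e')
    (Set.not_disjoint_iff.2 ⟨_, mem_image_of_mem _ hz, z', hz', h.symm⟩)
  obtain rfl : e = e' := by simpa using he
  rw [← RelCWComplex.source_eq k e] at hz hz'
  rw [(RelCWComplex.map k e).injOn hz hz' h]

/-- The union of the cells of dimension less than `k`. -/
def skel (X : Type*) [TopologicalSpace X] [T2Space X] [CWComplex (univ : Set X)] (k : ℕ) : Set X :=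
  (RelCWComplex.skeletonLT (univ : Set X) (k : ℕ∞) : Set X)

variable [T2Space X]

theorem isClosed_skel (k : ℕ) : IsClosed (skel X k) := RelCWComplex.Subcomplex.closed _

theorem skel_mono (h : m ≤ k) : skel X m ⊆ skel X k :=
  RelCWComplex.skeletonLT_mono (by exact_mod_cast h)

theorem charMap_mem_skel_of_lt (e : RelCWComplex.cell (univ : Set X) m) (h : m < k)
    {z : Fin m → ℝ} (hz : z ∈ closedBall 0 1) : charMap e z ∈ skel X k :=
  skel_mono h (by
    have := RelCWComplex.closedCell_subset_skeletonLT m e (mem_image_of_mem _ hz)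
    simpa [skel, charMap] using this)

theorem charMap_mem_skel_of_sphere (e : RelCWComplex.cell (univ : Set X) k)
    {z : Fin k → ℝ} (hz : z ∈ sphere 0 1) : charMap e z ∈ skel X k :=
  RelCWComplex.cellFrontier_subset_skeletonLT k e (mem_image_of_mem _ hz)

theorem charMap_notMem_skel (e : RelCWComplex.cell (univ : Set X) m) (h : k ≤ m)
    {z : Fin m → ℝ} (hz : z ∈ ball 0 1) : charMap e z ∉ skel X k := fun hm =>
  (RelCWComplex.disjoint_skeletonLT_openCell (C := (univ : Set X)) (n := (k : ℕ∞)) (j := e)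
    (by exact_mod_cast h)).le_bot ⟨hm, mem_image_of_mem _ hz⟩

theorem mem_skel_succ {x : X} (hx : x ∈ skel X (k + 1)) :
    x ∈ skel X k ∨ ∃ e, ∃ z ∈ ball 0 1, charMap (k := k) e z = x := by
  have hx' : x ∈ RelCWComplex.skeletonLT (univ : Set X) ((k + 1 : ℕ) : ℕ∞) := hx
  rw [CWComplex.mem_skeletonLT_iff] at hx'
  obtain ⟨m, hm, e, z, hz, rfl⟩ := hx'
  obtain hm | rfl : m < k ∨ m = k := by
    have : m < k + 1 := by exact_mod_cast hm
    omega
  · exact Or.inl (charMap_mem_skel_of_lt e hm (ball_subset_closedBall hz))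
  · exact Or.inr ⟨e, z, hz, rfl⟩

variable {T : Type*}

theorem exists_glue (a : X → T)
    (b : RelCWComplex.cell (univ : Set X) k → (Fin k → ℝ) → T) :
    ∃ g : X → T, (∀ x ∈ skel X k, g x = a x) ∧ ∀ e, ∀ z ∈ ball 0 1, g (charMap e z) = b e z := by
  classical
  refine ⟨fun x => if h : ∃ p : RelCWComplex.cell (univ : Set X) k × (Fin k → ℝ),
    p.2 ∈ ball 0 1 ∧ charMap p.1 p.2 = x then b h.choose.1 h.choose.2 else a x, fun x hx => ?_,
    fun e z hz => ?_⟩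
  · refine dif_neg ?_
    rintro ⟨p, hp, rfl⟩
    exact charMap_notMem_skel p.1 le_rfl hp hx
  · have h : ∃ p : RelCWComplex.cell (univ : Set X) k × (Fin k → ℝ),
        p.2 ∈ ball 0 1 ∧ charMap p.1 p.2 = charMap e z := ⟨(e, z), hz, rfl⟩
    refine (dif_pos h).trans ?_
    have := charMap_inj h.choose_spec.1 hz h.choose_spec.2
    simp only [Prod.mk.eta] at this
    rw [this]

variable [TopologicalSpace T]

/-- The weak topology, for a relatively open part of a skeleton. Adding the closed remainder `skel X
k \ O` to the preimage of a closed set makes its trace on each closed cell the image of a compact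
set. -/
theorem continuousOn_of_comp_charMap {O : Set X} (hO : O ⊆ skel X k)
    (hOc : IsClosed (skel X k \ O)) {g : X → T}
    (hg : ∀ m < k, ∀ e : RelCWComplex.cell (univ : Set X) m,
      ContinuousOn (g ∘ charMap e) (closedBall 0 1 ∩ charMap e ⁻¹' O)) : ContinuousOn g O := by
  rw [continuousOn_iff_isClosed]
  intro t ht
  refine ⟨(g ⁻¹' t ∩ O) ∪ (skel X k \ O), ?_, by ext x; simp; tauto⟩
  refine CWComplex.isClosed_of_disjoint_openCell_or_isClosed_inter_closedCell
    (C := (univ : Set X)) (subset_univ _) fun m _ e => ?_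
  obtain hm | hm := lt_or_ge m k
  · right
    obtain ⟨u, hu, hut⟩ := continuousOn_iff_isClosed.1 (hg m hm e) t ht
    have h1 : IsCompact ((u ∩ closedBall 0 1) ∪ (closedBall 0 1 ∩ charMap e ⁻¹' (skel X k \ O))) := by
      refine IsCompact.union ?_ ?_
      · exact (isCompact_closedBall _ _).inter_left hu
      · exact (isCompact_closedBall (0 : Fin m → ℝ) 1).of_isClosed_subset
          ((continuousOn_charMap e).preimage_isClosed_of_isClosed isClosed_closedBall hOc)
          inter_subset_left
    convert (h1.image_of_continuousOn ((continuousOn_charMap e).mono (by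
      rintro z (hz | hz); exacts [hz.2, hz.1]))).isClosed using 1
    have key : ∀ z ∈ closedBall (0 : Fin m → ℝ) 1, charMap e z ∈ O →
        (g (charMap e z) ∈ t ↔ z ∈ u) := by
      intro z hz hzO
      have := Set.ext_iff.1 hut z
      simp only [mem_inter_iff, mem_preimage, Function.comp, hz, hzO, and_true] at this
      exact this
    ext x
    constructor
    · rintro ⟨hx, z, hz, rfl⟩
      refine ⟨z, ?_, rfl⟩
      rcases hx with hx | hx
      · exact Or.inl ⟨(key z hz hx.2).1 hx.1, hz⟩
      · exact Or.inr ⟨hz, hx⟩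
    · rintro ⟨z, hz | hz, rfl⟩
      · refine ⟨?_, z, hz.2, rfl⟩
        by_cases hzO : charMap e z ∈ O
        · exact Or.inl ⟨(key z hz.2 hzO).2 hz.1, hzO⟩
        · exact Or.inr ⟨charMap_mem_skel_of_lt e hm hz.2, hzO⟩
      · exact ⟨Or.inr hz.2, z, hz.1, rfl⟩
  · left
    rw [Set.disjoint_left]
    rintro x hx ⟨z, hz, rfl⟩
    refine charMap_notMem_skel e hm hz ?_
    rcases hx with hx | hx
    exacts [hO hx.2, hx.1]

theorem continuousOn_glue {a : X → T} {b : RelCWComplex.cell (univ : Set X) k → (Fin k → ℝ) → T}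
    {g : X → T} (hga : ∀ x ∈ skel X k, g x = a x)
    (hgb : ∀ e, ∀ z ∈ ball 0 1, g (charMap e z) = b e z) {O : Set X} (hO : O ⊆ skel X (k + 1))
    (hOc : IsClosed (skel X (k + 1) \ O)) (ha : ContinuousOn a (skel X k ∩ O))
    (hb : ∀ e, ContinuousOn (b e) (closedBall 0 1 ∩ charMap e ⁻¹' O))
    (hab : ∀ e, ∀ z ∈ sphere 0 1, charMap e z ∈ O → b e z = a (charMap e z)) :
    ContinuousOn g O := by
  refine continuousOn_of_comp_charMap hO hOc fun m hm e => ?_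
  obtain hm | rfl : m < k ∨ m = k := by omega
  · refine ContinuousOn.congr (f := a ∘ charMap e) ?_ fun z hz =>
      hga _ (charMap_mem_skel_of_lt e hm hz.1)
    exact ha.comp ((continuousOn_charMap e).mono inter_subset_left)
      fun z hz => ⟨charMap_mem_skel_of_lt e hm hz.1, hz.2⟩
  · refine (hb e).congr fun z hz => ?_
    obtain h | h : z ∈ ball (0 : Fin m → ℝ) 1 ∨ z ∈ sphere (0 : Fin m → ℝ) 1 := by
      rw [← mem_union, ball_union_sphere]; exact hz.1
    · exact hgb e z h
    · exact (hga _ (charMap_mem_skel_of_sphere e h)).trans (hab e z h hz.2).symm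

end Skeleton

/-! ### Covering a CW complex by sets contractible in it -/

section Contraction

variable {X : Type*} [TopologicalSpace X]

/-- On the part of `S` where `f` is positive, the paths `G x` from `x` to `x₀` contract it
continuously to `x₀` in the ambient space. -/
structure IsContraction (x₀ : X) (S : Set X) (f : X → ℝ) (G : X → C(unitInterval, X)) : Prop where
  nonneg : ∀ x ∈ S, 0 ≤ f x
  continuousOn : ContinuousOn f S
  continuousOn_path : ContinuousOn G (S ∩ {x | 0 < f x})
  source : ∀ x ∈ S, 0 < f x → G x 0 = x
  target : ∀ x ∈ S, 0 < f x → G x 1 = x₀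

variable [T2Space X] [CWComplex (univ : Set X)] {k : ℕ} {x₀ : X}

/-- Closed cells are path connected, so a path component and its complement are both unions of
closed cells; such unions are closed in the weak topology. -/
theorem joined_of_connected [ConnectedSpace X] (x y : X) : Joined x y := by
  have key : ∀ A : Set X, (∀ n (j : RelCWComplex.cell (univ : Set X) n),
      (A ∩ RelCWComplex.closedCell n j).Nonempty → RelCWComplex.closedCell n j ⊆ A) →
      IsClosed A := by
    intro A hA
    refine (CWComplex.closed (univ : Set X) A (subset_univ _)).2 fun n j => ?_
    obtain h | h := (A ∩ RelCWComplex.closedCell n j).eq_empty_or_nonempty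
    · rw [h]; exact isClosed_empty
    · rw [inter_eq_self_of_subset_right (hA n j h)]
      exact RelCWComplex.isClosed_closedCell
  have hcell : ∀ n (j : RelCWComplex.cell (univ : Set X) n), ∀ a ∈ RelCWComplex.closedCell n j,
      ∀ b ∈ RelCWComplex.closedCell n j, Joined a b := by
    intro n j a ha b hb
    have : IsPathConnected (RelCWComplex.closedCell n j) :=
      ((convex_closedBall (0 : Fin n → ℝ) 1).isPathConnected ⟨0, by simp⟩).image'
        (RelCWComplex.continuousOn n j)
    exact (this.joinedIn a ha b hb).joined
  have h : IsClopen (pathComponent x) := by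
    refine ⟨key _ fun n j ⟨a, ha, ha'⟩ b hb => ha.trans (hcell n j a ha' b hb),
      isClosed_compl_iff.1 (key _ fun n j ⟨a, ha, ha'⟩ b hb hbx => ha ?_)⟩
    exact Joined.trans hbx (hcell n j b hb a ha')
  have hy : y ∈ pathComponent x := by
    rw [h.eq_univ ⟨x, mem_pathComponent_self x⟩]; trivial
  exact hy

theorem IsContraction.exists_extend {f₀ : X → ℝ} {G₀ : X → C(unitInterval, X)}
    (h : IsContraction x₀ (skel X k) f₀ G₀)
    {b : RelCWComplex.cell (univ : Set X) k → (Fin k → ℝ) → ℝ}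
    {F : RelCWComplex.cell (univ : Set X) k → (Fin k → ℝ) × unitInterval → X}
    (hb0 : ∀ e, ∀ z ∈ ball 0 1, 0 ≤ b e z) (hb : ∀ e, ContinuousOn (b e) (closedBall 0 1))
    (hF : ∀ e, ContinuousOn (F e) ((closedBall 0 1 ∩ {z | 0 < b e z}) ×ˢ univ))
    (hF0 : ∀ e, ∀ z ∈ ball 0 1, 0 < b e z → F e (z, 0) = charMap e z)
    (hF1 : ∀ e, ∀ z ∈ ball 0 1, 0 < b e z → F e (z, 1) = x₀)
    (hbs : ∀ e, ∀ z ∈ sphere 0 1, b e z = f₀ (charMap e z))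
    (hFs : ∀ e, ∀ z ∈ sphere 0 1, 0 < b e z → ∀ t, F e (z, t) = G₀ (charMap e z) t) :
    ∃ f G, IsContraction x₀ (skel X (k + 1)) f G ∧ (∀ x ∈ skel X k, f x = f₀ x) ∧
      ∀ e, ∀ z ∈ ball 0 1, f (charMap e z) = b e z := by
  have : Nonempty X := ⟨x₀⟩
  choose s hs hsF using fun e => exists_continuousOn_curry (hF e)
  obtain ⟨f, hff₀, hfb⟩ := exists_glue (X := X) f₀ b
  obtain ⟨G, hGG₀, hGs⟩ := exists_glue (X := X) G₀ s
  have hfc : ContinuousOn f (skel X (k + 1)) :=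
    continuousOn_glue hff₀ hfb subset_rfl (by simp) (h.continuousOn.mono inter_subset_left)
      (fun e => (hb e).mono inter_subset_left) fun e z hz _ => hbs e z hz
  have hfb' : ∀ e, ∀ z ∈ closedBall 0 1, f (charMap e z) = b e z := by
    intro e z hz
    rw [← ball_union_sphere] at hz
    rcases hz with hz | hz
    · exact hfb e z hz
    · rw [hff₀ _ (charMap_mem_skel_of_sphere e hz), hbs e z hz]
  refine ⟨f, G, ⟨fun x hx => ?_, hfc, ?_, fun x hx hfx => ?_, fun x hx hfx => ?_⟩, hff₀, hfb⟩
  · obtain hx | ⟨e, z, hz, rfl⟩ := mem_skel_succ hx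
    · rw [hff₀ x hx]; exact h.nonneg x hx
    · rw [hfb e z hz]; exact hb0 e z hz
  · refine continuousOn_glue hGG₀ hGs inter_subset_left ?_ ?_ (fun e => ?_) fun e z hz hO => ?_
    · convert hfc.preimage_isClosed_of_isClosed (isClosed_skel _) (isClosed_Iic (a := 0)) using 1
      ext x
      simp +contextual
    · refine h.continuousOn_path.mono ?_
      rintro x ⟨hx, -, hx'⟩
      refine ⟨hx, ?_⟩
      rwa [mem_ofPred_eq, hff₀ x hx] at hx'
    · refine (hs e).mono ?_
      rintro z ⟨hz, -, hz'⟩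
      refine ⟨hz, ?_⟩
      rwa [mem_ofPred_eq, hfb' e z hz] at hz'
    · have hz' : z ∈ closedBall (0 : Fin k → ℝ) 1 := sphere_subset_closedBall hz
      have hO2 : 0 < b e z := by rw [← hfb' e z hz']; exact hO.2
      ext t
      rw [hsF e z ⟨hz', hO2⟩, hFs e z hz hO2]
  · obtain hx | ⟨e, z, hz, rfl⟩ := mem_skel_succ hx
    · rw [hff₀ x hx] at hfx
      rw [hGG₀ x hx, h.source x hx hfx]
    · rw [hfb e z hz] at hfx
      rw [hGs e z hz, hsF e z ⟨ball_subset_closedBall hz, hfx⟩, hF0 e z hz hfx]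
  · obtain hx | ⟨e, z, hz, rfl⟩ := mem_skel_succ hx
    · rw [hff₀ x hx] at hfx
      rw [hGG₀ x hx, h.target x hx hfx]
    · rw [hfb e z hz] at hfx
      rw [hGs e z hz, hsF e z ⟨ball_subset_closedBall hz, hfx⟩, hF1 e z hz hfx]

theorem exists_isContraction_cells [ConnectedSpace X] (x₀ : X) (k : ℕ) :
    ∃ f G, IsContraction x₀ (skel X (k + 1)) f G ∧
      ∀ x ∈ skel X (k + 1), x ∉ skel X k → 0 < f x := by
  have h0 : IsContraction x₀ (skel X k) (fun _ => 0) (fun _ => ContinuousMap.const _ x₀) :=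
    ⟨by simp, continuousOn_const, continuousOn_const, by simp, by simp⟩
  let P := fun e : RelCWComplex.cell (univ : Set X) k =>
    (joined_of_connected (charMap e 0) x₀).somePath
  -- Shrink each open cell to its centre, then follow a path to `x₀`. The `max 0` keeps the unused
  -- branch inside the closed ball, where continuity is known.
  refine (h0.exists_extend (b := fun _ z => 1 - ‖z‖)
    (F := fun e p => if 0 ≤ 2 * (p.2 : ℝ) - 1 then (P e).extend (2 * p.2 - 1)
      else charMap e (max 0 (1 - 2 * (p.2 : ℝ)) • p.1))
    (fun e z hz => by simpa using (mem_ball_zero_iff.1 hz).le) (fun e => by fun_prop)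
    (fun e => continuousOn_if_nonneg
      (Continuous.continuousOn (by fun_prop))
      ((continuousOn_charMap e).comp (Continuous.continuousOn (by fun_prop)) fun p hp => ?_)
      (by fun_prop) fun p hp h0 => ?_)
    (fun e z hz _ => by simp) (fun e z hz _ => by norm_num)
    (fun e z hz => by simp [mem_sphere_zero_iff_norm.1 hz])
    (fun e z hz h => by simp [mem_sphere_zero_iff_norm.1 hz] at h)).imp fun f =>
    Exists.imp fun G ⟨h, _, hf⟩ => ⟨h, fun x hx hx' => ?_⟩
  rotate_left 2
  · obtain ⟨e, z, hz, rfl⟩ := (mem_skel_succ hx).resolve_left hx'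
    rw [hf e z hz]
    simpa using hz
  · have h1 := hp.1.1
    have h2 := p.2.2.1
    rw [mem_closedBall_zero_iff] at h1 ⊢
    rw [norm_smul, Real.norm_of_nonneg (le_max_left _ _)]
    exact mul_le_one₀ (max_le (by norm_num) (by linarith)) (norm_nonneg _) h1
  · have : 1 - 2 * (p.2 : ℝ) = 0 := by linarith
    simp [h0, this]

/-- One parameter `s` governs two motions: for negative `s` the point is at radius `1 + s` on the
ray through `w`, and for positive `s` it follows the given contraction from the boundary. The clamps
make both branches meaningful for every `s`. -/
theorem IsContraction.continuousOn_slide {f₀ : X → ℝ} {G₀ : X → C(unitInterval, X)}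
    (h : IsContraction x₀ (skel X k) f₀ G₀) {e : RelCWComplex.cell (univ : Set X) k}
    {W : Type*} [TopologicalSpace W] {D : Set W} {w : W → Fin k → ℝ} {s : W → ℝ}
    (hw : ContinuousOn w D) (hs : ContinuousOn s D) (hw1 : ∀ p ∈ D, w p ∈ sphere 0 1)
    (hfw : ∀ p ∈ D, 0 < f₀ (charMap e (w p))) (hs1 : ∀ p ∈ D, -1 ≤ s p) :
    ContinuousOn (fun p => if 0 ≤ s p then
        G₀ (charMap e (w p)) (projIcc 0 1 zero_le_one (s p))
      else charMap e ((1 + min 0 (s p)) • w p)) D := by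
  have h1 : ContinuousOn (fun p => G₀ (charMap e (w p))) D :=
    h.continuousOn_path.comp ((continuousOn_charMap e).comp hw
      fun p hp => sphere_subset_closedBall (hw1 p hp))
      fun p hp => ⟨charMap_mem_skel_of_sphere e (hw1 p hp), hfw p hp⟩
  have h2 : ContinuousOn (fun p => projIcc (0 : ℝ) 1 zero_le_one (s p)) D :=
    continuous_projIcc.comp_continuousOn hs
  refine continuousOn_if_nonneg (continuous_eval.comp_continuousOn (h1.prodMk h2))
    ((continuousOn_charMap e).comp ((continuousOn_const.add (continuousOn_const.inf hs)).smul hw)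
      fun p hp => ?_) hs fun p hp h0 => ?_
  · rw [mem_closedBall_zero_iff, norm_smul,
      mem_sphere_zero_iff_norm.1 (hw1 p hp), mul_one, Real.norm_eq_abs, abs_le]
    constructor
    · have : -1 ≤ min 0 (s p) := le_min (by norm_num) (hs1 p hp)
      linarith
    · linarith [min_le_left 0 (s p)]
  · rw [h0, min_self, add_zero, one_smul, projIcc_left]
    exact h.source _ (charMap_mem_skel_of_sphere e (hw1 p hp)) (hfw p hp)

theorem IsContraction.exists_extend_skel_succ {f₀ : X → ℝ} {G₀ : X → C(unitInterval, X)}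
    (h : IsContraction x₀ (skel X k) f₀ G₀) :
    ∃ f G, IsContraction x₀ (skel X (k + 1)) f G ∧ ∀ x ∈ skel X k, f x = f₀ x := by
  have hw : ∀ z : Fin k → ℝ, z ≠ 0 → ‖z‖⁻¹ • z ∈ sphere (0 : Fin k → ℝ) 1 := by
    intro z hz
    rw [mem_sphere_zero_iff_norm, norm_smul, norm_inv, norm_norm,
      inv_mul_cancel₀ (norm_ne_zero_iff.2 hz)]
  have hr : ∀ (e : RelCWComplex.cell (univ : Set X) k) (z : Fin k → ℝ),
      0 < max 0 (2 * ‖z‖ - 1) * f₀ (charMap e (‖z‖⁻¹ • z)) → 1 / 2 < ‖z‖ := by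
    intro e z hz
    by_contra! hz'
    rw [max_eq_left (by linarith), zero_mul] at hz
    exact hz.false
  have hf₀ : ∀ (e : RelCWComplex.cell (univ : Set X) k) (z : Fin k → ℝ),
      0 < max 0 (2 * ‖z‖ - 1) * f₀ (charMap e (‖z‖⁻¹ • z)) → 0 < f₀ (charMap e (‖z‖⁻¹ • z)) :=
    fun e z hz => pos_of_mul_pos_right hz (le_max_left _ _)
  have hn0 : ∀ z : Fin k → ℝ, 1 / 2 ≤ ‖z‖ → z ≠ 0 := by
    rintro z hz rfl
    norm_num at hz
  -- The cut-off `2 * ‖z‖ - 1` kills the function on the inner half of the ball, away from which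
  -- radial projection is continuous. The slide parameter runs from `‖z‖ - 1`, the point itself, to
  -- `1`, the end of the contraction, and equals the time on the sphere.
  refine (h.exists_extend
    (b := fun e z => max 0 (2 * ‖z‖ - 1) * f₀ (charMap e (‖z‖⁻¹ • z)))
    (F := fun e p => if 0 ≤ ‖p.1‖ - 1 + p.2 * (2 - ‖p.1‖) then
      G₀ (charMap e (‖p.1‖⁻¹ • p.1))
        (projIcc 0 1 zero_le_one (‖p.1‖ - 1 + p.2 * (2 - ‖p.1‖)))
      else charMap e ((1 + min 0 (‖p.1‖ - 1 + p.2 * (2 - ‖p.1‖))) • ‖p.1‖⁻¹ • p.1))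
    (fun e z hz => ?_) (fun e => ?_)
    (fun e => ?_)
    (fun e z hz hb => ?_) (fun e z hz hb => ?_) (fun e z hz => ?_)
    (fun e z hz hb t => ?_)).imp fun f => Exists.imp fun G h => ⟨h.1, h.2.1⟩
  · obtain h' | h' := le_or_gt ‖z‖ (1 / 2)
    · rw [max_eq_left (by linarith), zero_mul]
    · exact mul_nonneg (le_max_left _ _)
        (h.nonneg _ (charMap_mem_skel_of_sphere e (hw z (hn0 z h'.le))))
  · have h1 : closedBall (0 : Fin k → ℝ) 1 ⊆ {z | ‖z‖ ≤ 1 / 2} ∪ {z | 1 / 2 ≤ ‖z‖} :=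
      fun z _ => le_total ‖z‖ (1 / 2)
    refine ContinuousOn.mono (ContinuousOn.union_of_isClosed ?_ ?_
      (isClosed_le continuous_norm continuous_const)
      (isClosed_le continuous_const continuous_norm)) h1
    · refine (continuousOn_const (c := (0 : ℝ))).congr fun z hz => ?_
      have : ‖z‖ ≤ 1 / 2 := hz
      rw [max_eq_left (by linarith), zero_mul]
    · refine ContinuousOn.mul (by fun_prop) (h.continuousOn.comp
        (t := skel X k) ((continuousOn_charMap e).comp (t := closedBall 0 1) ?_ ?_) ?_)
      · exact (continuous_norm.continuousOn.inv₀ fun z hz =>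
          norm_ne_zero_iff.2 (hn0 z hz)).smul continuousOn_id
      · exact fun z hz => sphere_subset_closedBall (hw z (hn0 z hz))
      · exact fun z hz => charMap_mem_skel_of_sphere e (hw z (hn0 z hz))
  · have hwc : ContinuousOn (fun p : (Fin k → ℝ) × unitInterval => ‖p.1‖⁻¹ • p.1)
        ((closedBall 0 1 ∩ {z | 0 < max 0 (2 * ‖z‖ - 1) * f₀ (charMap e (‖z‖⁻¹ • z))}) ×ˢ
          univ) :=
      ((continuous_fst.norm.continuousOn.inv₀ fun p hp =>
          norm_ne_zero_iff.2 (hn0 p.1 (hr e p.1 hp.1.2).le)).smul continuousOn_fst)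
    refine h.continuousOn_slide hwc (by fun_prop) (fun p hp => hw _ (hn0 p.1 (hr e p.1 hp.1.2).le))
      (fun p hp => hf₀ e _ hp.1.2) fun p hp => ?_
    have h3 : 0 ≤ (p.2 : ℝ) * (2 - ‖p.1‖) :=
      mul_nonneg p.2.2.1 (by linarith [mem_closedBall_zero_iff.1 hp.1.1])
    linarith [norm_nonneg p.1]
  · have h1 := mem_ball_zero_iff.1 hz
    have h2 := hn0 z (hr e z hb).le
    simp only [Icc.coe_zero, zero_mul, add_zero]
    rw [if_neg (by linarith), min_eq_right (by linarith), add_sub_cancel, smul_smul,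
      mul_inv_cancel₀ (norm_ne_zero_iff.2 h2), one_smul]
  · have h2 := hn0 z (hr e z hb).le
    have h3 : ‖z‖ - 1 + ((1 : unitInterval) : ℝ) * (2 - ‖z‖) = 1 := by
      rw [Icc.coe_one]; ring
    simp only [h3]
    rw [if_pos zero_le_one, projIcc_right]
    exact h.target _ (charMap_mem_skel_of_sphere e (hw _ h2)) (hf₀ e _ hb)
  · rw [mem_sphere_zero_iff_norm.1 hz]
    norm_num
  · have h3 : ‖z‖ - 1 + (t : ℝ) * (2 - ‖z‖) = t := by
      rw [mem_sphere_zero_iff_norm.1 hz]; ring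
    simp only [h3]
    rw [if_pos t.2.1, projIcc_val, mem_sphere_zero_iff_norm.1 hz, inv_one, one_smul]

/-- Passing to the next skeleton, the old functions are extended without changing their values, and
a single new one is positive on all the new open cells. -/
theorem exists_isContraction_cover [ConnectedSpace X] (x₀ : X) (k : ℕ) :
    ∃ (f : ℕ → X → ℝ) (G : ℕ → X → C(unitInterval, X)),
      (∀ i < k, IsContraction x₀ (skel X k) (f i) (G i)) ∧
      ∀ x ∈ skel X k, ∃ i < k, 0 < f i x := by
  induction k with
  | zero =>
    refine ⟨fun _ _ => 0, fun _ _ => ContinuousMap.const _ x₀, by simp, fun x hx => ?_⟩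
    rw [skel, Nat.cast_zero, CWComplex.skeletonLT_zero_eq_empty] at hx
    exact hx.elim
  | succ k ih =>
    obtain ⟨f, G, hfG, hf⟩ := ih
    have : Nonempty C(unitInterval, X) := ⟨ContinuousMap.const _ x₀⟩
    choose! f' G' hfG' hf' using fun i hi => (hfG i hi).exists_extend_skel_succ
    obtain ⟨f'', G'', hfG'', hf''⟩ := exists_isContraction_cells x₀ k
    refine ⟨fun i => if i < k then f' i else f'', fun i => if i < k then G' i else G'',
      fun i _ => ?_, fun x hx => ?_⟩
    · dsimp only
      split_ifs with h
      exacts [hfG' i h, hfG'']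
    · by_cases hx' : x ∈ skel X k
      · obtain ⟨i, hi, hix⟩ := hf x hx'
        refine ⟨i, by omega, ?_⟩
        simpa only [if_pos hi, hf' i hi x hx']
      · exact ⟨k, by omega, by simpa using hf'' x hx hx'⟩

end Contraction

/-! ### From contractible pieces to motion planners -/

section UpperBound

variable {X : Type*} [TopologicalSpace X]

theorem hasMotionPlanner_of_continuousOn {U : Set (X × X)} {s : X × X → C(unitInterval, X)}
    (hs : ContinuousOn s U) (h0 : ∀ z ∈ U, s z 0 = z.1) (h1 : ∀ z ∈ U, s z 1 = z.2) :
    HasMotionPlanner U :=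
  ⟨⟨_, hs.domRestrict⟩, fun z => ⟨h0 z z.2, h1 z z.2⟩⟩

/-- Two contractible pieces give a motion planner on their product: contract one end point and
return to the other one. -/
theorem IsContraction.exists_planner {x₀ : X} {f g : X → ℝ} {G H : X → C(unitInterval, X)}
    (hf : IsContraction x₀ univ f G) (hg : IsContraction x₀ univ g H) :
    ∃ s : X × X → C(unitInterval, X), ContinuousOn s {z | 0 < f z.1 ∧ 0 < g z.2} ∧
      ∀ z : X × X, 0 < f z.1 → 0 < g z.2 → s z 0 = z.1 ∧ s z 1 = z.2 := by
  have : Nonempty X := ⟨x₀⟩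
  have hG : ContinuousOn G {x | 0 < f x} := by simpa using hf.continuousOn_path
  have hH : ContinuousOn H {x | 0 < g x} := by simpa using hg.continuousOn_path
  obtain ⟨s, hs, hsF⟩ := exists_continuousOn_curry (X := X) (Z := X × X)
    (D := {z | 0 < f z.1 ∧ 0 < g z.2})
    (F := fun p => if 0 ≤ 1 - 2 * (p.2 : ℝ) then
        G p.1.1 (projIcc 0 1 zero_le_one (2 * (p.2 : ℝ)))
      else H p.1.2 (projIcc 0 1 zero_le_one (2 - 2 * (p.2 : ℝ)))) (by
    have hproj : ∀ u : (X × X) × unitInterval → ℝ, Continuous u →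
        Continuous fun p => projIcc (0 : ℝ) 1 zero_le_one (u p) := fun u hu =>
      continuous_projIcc.comp hu
    refine continuousOn_if_nonneg ?_ ?_ (by fun_prop) fun p hp h0 => ?_
    · refine continuous_eval.comp_continuousOn (ContinuousOn.prodMk ?_
        (hproj _ (by fun_prop)).continuousOn)
      exact hG.comp continuous_fst.fst.continuousOn fun p hp => hp.1.1
    · refine continuous_eval.comp_continuousOn (ContinuousOn.prodMk ?_
        (hproj _ (by fun_prop)).continuousOn)
      exact hH.comp continuous_fst.snd.continuousOn fun p hp => hp.1.2
    · have h1 : 2 * (p.2 : ℝ) = 1 := by linarith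
      have h2 : 2 - 2 * (p.2 : ℝ) = 1 := by linarith
      rw [h2, h1, projIcc_right]
      exact (hf.target _ trivial hp.1.1).trans (hg.target _ trivial hp.1.2).symm)
  refine ⟨s, hs, fun z hz1 hz2 => ?_⟩
  rw [hsF z ⟨hz1, hz2⟩, hsF z ⟨hz1, hz2⟩]
  constructor
  · simp only [Icc.coe_zero, mul_zero, sub_zero]
    rw [if_pos zero_le_one, projIcc_left]
    exact hf.source _ trivial hz1
  · simp only [Icc.coe_one, mul_one, sub_self]
    rw [if_neg (by norm_num), projIcc_left]
    exact hg.source _ trivial hz2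

/-- The points where the functions in `R` are positive and exceed those not in `R`. -/
def dominance {Z ι : Type*} (h : ι → Z → ℝ) (R : Finset ι) : Set Z :=
  {z | (∀ k ∈ R, 0 < h k z) ∧ ∀ k ∈ R, ∀ l ∉ R, h l z < h k z}

theorem isOpen_dominance {Z ι : Type*} [TopologicalSpace Z] [Finite ι] {h : ι → Z → ℝ}
    (hc : ∀ k, Continuous (h k)) (R : Finset ι) : IsOpen (dominance h R) := by
  have : dominance h R = (⋂ k, ⋂ (_ : k ∈ R), {z | 0 < h k z}) ∩
      ⋂ k, ⋂ (_ : k ∈ R), ⋂ l, ⋂ (_ : l ∉ R), {z | h l z < h k z} := by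
    ext z
    simp [dominance]
  rw [this]
  refine IsOpen.inter ?_ ?_
  · exact isOpen_iInter_of_finite fun k => isOpen_iInter_of_finite fun _ =>
      isOpen_lt continuous_const (hc k)
  · exact isOpen_iInter_of_finite fun k => isOpen_iInter_of_finite fun _ =>
      isOpen_iInter_of_finite fun l => isOpen_iInter_of_finite fun _ => isOpen_lt (hc l) (hc k)

theorem eq_of_mem_dominance {Z ι : Type*} [DecidableEq ι] {h : ι → Z → ℝ} {R S : Finset ι}
    (hRS : R.card = S.card) {z : Z} (hR : z ∈ dominance h R) (hS : z ∈ dominance h S) :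
    R = S := by
  by_contra hne
  obtain ⟨k, hkR, hkS⟩ : ∃ k ∈ R, k ∉ S := by
    by_contra! hc
    exact hne (Finset.eq_of_subset_of_card_le hc hRS.ge)
  obtain ⟨l, hlS, hlR⟩ : ∃ l ∈ S, l ∉ R := by
    by_contra! hc
    exact hne (Finset.eq_of_subset_of_card_le hc hRS.le).symm
  exact (hR.2 k hkR l hlR).asymm (hS.2 l hlS k hkS)

/-- There are `2 * N + 2` functions on the product, and dominance sets of equally large index sets
are equal or disjoint, so planners on them combine. The relevant sizes run from `2` to `2 * N + 2`,
which leaves `2 * N + 1` open sets. -/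
theorem TC_le_of_contractions {x₀ : X} {N : ℕ} {f : Fin (N + 1) → X → ℝ}
    {G : Fin (N + 1) → X → C(unitInterval, X)} (hfG : ∀ i, IsContraction x₀ univ (f i) (G i))
    (hf : ∀ x, ∃ i, 0 < f i x) : TC X ≤ (2 * N : ℕ) := by
  classical
  have hfc : ∀ i, Continuous (f i) := fun i => continuousOn_univ.1 (hfG i).continuousOn
  let M : X → ℝ := fun x => Finset.univ.sup' Finset.univ_nonempty fun i => f i x
  have hMc : Continuous M := Continuous.finset_sup'_apply _ fun i _ => hfc i
  have hMle : ∀ i x, f i x ≤ M x := fun i x =>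
    Finset.le_sup' (fun i => f i x) (Finset.mem_univ i)
  have hMpos : ∀ x, 0 < M x := fun x => by
    obtain ⟨i, hi⟩ := hf x
    exact hi.trans_le (hMle i x)
  have hMeq : ∀ x, ∃ i, f i x / M x = 1 := fun x => by
    obtain ⟨i, -, hi⟩ := Finset.exists_mem_eq_sup' Finset.univ_nonempty fun i => f i x
    exact ⟨i, (div_eq_one_iff_eq (hMpos x).ne').2 hi.symm⟩
  have hMle1 : ∀ i x, f i x / M x ≤ 1 := fun i x => (div_le_one (hMpos x)).2 (hMle i x)
  -- Dividing by the maximum makes the largest value on either factor equal to `1`. The set of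
  -- indices attaining it therefore contains one from each factor, which is what a planner needs.
  let h : Fin (N + 1) ⊕ Fin (N + 1) → X × X → ℝ :=
    Sum.elim (fun i z => f i z.1 / M z.1) fun j z => f j z.2 / M z.2
  have hc : ∀ k, Continuous (h k) := by
    rintro (i | j)
    · exact ((hfc i).comp continuous_fst).div (hMc.comp continuous_fst) fun z => (hMpos _).ne'
    · exact ((hfc j).comp continuous_snd).div (hMc.comp continuous_snd) fun z => (hMpos _).ne'
  have hle : ∀ k z, h k z ≤ 1 := by
    rintro (i | j) z
    exacts [hMle1 i z.1, hMle1 j z.2]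
  have hfpos : ∀ i x, 0 < f i x / M x → 0 < f i x := fun i x hp =>
    (div_pos_iff_of_pos_right (hMpos x)).1 hp
  choose s hsc hs using fun i j => (hfG i).exists_planner (hfG j)
  let P : ℕ → Finset (Fin (N + 1) ⊕ Fin (N + 1)) → Prop := fun m R =>
    R.card = m + 2 ∧ (∃ i, Sum.inl i ∈ R) ∧ ∃ j, Sum.inr j ∈ R
  refine iInf₂_le (2 * N) ⟨fun m => ⋃ R, ⋃ (_ : P m R), dominance h R, fun m =>
    isOpen_iUnion fun R => isOpen_iUnion fun _ => isOpen_dominance hc R, ?_, fun m => ?_⟩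
  · refine eq_univ_of_forall fun z => ?_
    obtain ⟨i, hi⟩ := hMeq z.1
    obtain ⟨j, hj⟩ := hMeq z.2
    let R := Finset.univ.filter fun k => h k z = 1
    have hiR : Sum.inl i ∈ R := by simpa [R, h] using hi
    have hjR : Sum.inr j ∈ R := by simpa [R, h] using hj
    have h2 : 1 < R.card := Finset.one_lt_card.2 ⟨_, hiR, _, hjR, by simp⟩
    have h3 : R.card ≤ 2 * N + 2 := by
      refine (Finset.card_le_univ R).trans ?_
      simp
      omega
    refine mem_iUnion.2 ⟨⟨R.card - 2, by omega⟩, mem_iUnion₂.2 ⟨R, ⟨by dsimp only; omega,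
      ⟨i, hiR⟩, ⟨j, hjR⟩⟩, fun k hk => ?_, fun k hk l hl => ?_⟩⟩
    · rw [(Finset.mem_filter.1 hk).2]
      exact one_pos
    · rw [(Finset.mem_filter.1 hk).2]
      exact lt_of_le_of_ne (hle l z) fun hl' => hl (Finset.mem_filter.2 ⟨Finset.mem_univ _, hl'⟩)
  -- The pair of contractions is chosen as a function of the point, constant on each dominance set;
  -- as these are open, the planner is locally one of the `s i j`.
  · have hex : ∀ z : X × X, ∃ p : Fin (N + 1) × Fin (N + 1), ∀ R, P m R → z ∈ dominance h R →
        p = (if hR : P m R then (hR.2.1.choose, hR.2.2.choose) else p) := by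
      intro z
      by_cases hz : ∃ R, P m R ∧ z ∈ dominance h R
      · obtain ⟨R, hR, hzR⟩ := hz
        refine ⟨(hR.2.1.choose, hR.2.2.choose), fun S hS hzS => ?_⟩
        obtain rfl := eq_of_mem_dominance (hR.1.trans hS.1.symm) hzR hzS
        rw [dif_pos hR]
      · exact ⟨(0, 0), fun R hR hzR => (hz ⟨R, hR, hzR⟩).elim⟩
    choose p hp using hex
    have hpR : ∀ R, ∀ hR : P m R, ∀ z ∈ dominance h R,
        p z = (hR.2.1.choose, hR.2.2.choose) := fun R hR z hz => by
      rw [hp z R hR hz, dif_pos hR]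
    have hpos : ∀ R, ∀ hR : P m R, ∀ z ∈ dominance h R,
        0 < f hR.2.1.choose z.1 ∧ 0 < f hR.2.2.choose z.2 := fun R hR z hz =>
      ⟨hfpos _ _ (hz.1 _ hR.2.1.choose_spec), hfpos _ _ (hz.1 _ hR.2.2.choose_spec)⟩
    refine hasMotionPlanner_of_continuousOn (s := fun z => s (p z).1 (p z).2 z) ?_ ?_ ?_
    · rintro z hz
      obtain ⟨R, hR, hzR⟩ := mem_iUnion₂.1 hz
      refine ContinuousAt.continuousWithinAt ?_
      have hR' := (isOpen_dominance hc R).mem_nhds hzR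
      refine ContinuousAt.congr (((hsc hR.2.1.choose hR.2.2.choose).mono
        (hpos R hR)).continuousAt hR') ?_
      filter_upwards [hR'] with w hw
      rw [hpR R hR w hw]
    · intro z hz
      obtain ⟨R, hR, hzR⟩ := mem_iUnion₂.1 hz
      rw [hpR R hR z hzR]
      exact (hs _ _ z (hpos R hR z hzR).1 (hpos R hR z hzR).2).1
    · intro z hz
      obtain ⟨R, hR, hzR⟩ := mem_iUnion₂.1 hz
      rw [hpR R hR z hzR]
      exact (hs _ _ z (hpos R hR z hzR).1 (hpos R hR z hzR).2).2

theorem skel_eq_univ [T2Space X] [CWComplex (univ : Set X)] {N : ℕ}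
    (hdim : cwDim X ≤ ((N : ℕ∞) : WithBot ℕ∞)) : skel X (N + 1) = univ := by
  refine eq_univ_of_forall fun x => ?_
  have hx : x ∈ ⋃ (m : ℕ) (e : RelCWComplex.cell (univ : Set X) m),
      RelCWComplex.closedCell m e := by
    rw [CWComplex.union]; trivial
  obtain ⟨m, e, z, hz, rfl⟩ := by simpa only [mem_iUnion] using hx
  refine charMap_mem_skel_of_lt e ?_ hz
  have h : ((m : ℕ∞) : WithBot ℕ∞) ≤ cwDim X :=
    le_iSup₂ (f := fun (m : ℕ) (_ : Nonempty (RelCWComplex.cell (univ : Set X) m)) =>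
      ((m : ℕ∞) : WithBot ℕ∞)) m ⟨e⟩
  have : m ≤ N := by exact_mod_cast h.trans hdim
  omega

theorem TC_le [T2Space X] [CWComplex (univ : Set X)] [ConnectedSpace X] {N : ℕ}
    (hdim : cwDim X ≤ ((N : ℕ∞) : WithBot ℕ∞)) : TC X ≤ (2 * N : ℕ) := by
  obtain ⟨f, G, hfG, hf⟩ := exists_isContraction_cover (Classical.arbitrary X) (N + 1)
  rw [skel_eq_univ hdim] at hfG hf
  refine TC_le_of_contractions (f := fun i : Fin (N + 1) => f i) (fun i => hfG i i.2) fun x => ?_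
  obtain ⟨i, hi, hfi⟩ := hf x trivial
  exact ⟨⟨i, hi⟩, hfi⟩

end UpperBound

end

end TopCpx

theorem theorem1p1 {X : Type*} [TopologicalSpace X] [T2Space X]
    [Topology.CWComplex (Set.univ : Set X)] [ConnectedSpace X]
    (n : ℕ) (hdim : TopCpx.cwDim X = ((2 * n : ℕ) : ℕ∞))
    {F : Type*} [Field F] (hF : ringChar F = 0 ∨ 2 * n < ringChar F)
    (hu : ∃ u : TopCpx.H 2 X F, TopCpx.Atoroidal u ∧ TopCpx.cupPow u n ≠ 0) :
    (TopCpx.TC X : WithBot ℕ∞) = 2 * TopCpx.cwDim X ∧ TopCpx.TC X = (4 * n : ℕ) := by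
  obtain ⟨u, hu, hun⟩ := hu
  have h : TopCpx.TC X = (4 * n : ℕ) := by
    refine le_antisymm ((TopCpx.TC_le hdim.le).trans_eq ?_) (TopCpx.le_TC hF hu hun)
    congr 1
    omega
  refine ⟨?_, h⟩
  rw [h, hdim, show 4 * n = 2 * (2 * n) by omega]
  push_cast
  rfl
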